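/- Let $\kappa,N\ge 1$ be integers, $k=\kappa+\tfrac12$, and let $\chi$ be a Dirichlet character modulo $4N$; for $\gamma=\begin{pmatrix}a&b\\c&e\end{pmatrix}\in\Gamma_0(4N)$ write $\chi(\gamma)=\chi(e)$. Let $\mathfrak G$ be Shimura's covering group of $GL_2^+(\mathbb R)$: the pairs $(\alpha,\varphi)$ with $\alpha=\begin{pmatrix}a&b\\c&e\end{pmatrix}\in GL_2^+(\mathbb R)$ and $\varphi$ holomorphic on the upper half plane $\mathbb H$ with $\varphi(z)^2=t\det(\alpha)^{-1/2}(cz+e)$ for a constant $t$, $|t|=1$, with product $(\alpha,\varphi(z))(\beta,\psi(z))=(\alpha\beta,\varphi(\beta z)\psi(z))$. It acts by $f|_k(\alpha,\varphi)(z)=f(\alpha z)\varphi(z)^{-2k}$. Embed $\Gamma_0(4)$ in $\mathfrak G$ by $\gamma\mapsto\gamma^*=(\gamma,j(\gamma,z))$, where for $\gamma=\begin{pmatrix}a&b\\c&e\end{pmatrix}$ one has $j(\gamma,z)=\varepsilon_e^{-1}\left(\tfrac ce\right)(cz+e)^{1/2}$ (the theta multiplier, with Shimura's quadratic residue symbol,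 $\varepsilon_e=1$ or $i$ according as $e\equiv 1$ or $3\bmod 4$, and the square root with argument in $(-\pi/2,\pi/2]$), and let $\Delta_0(4N)$ be the image of $\Gamma_0(4N)$. Let $S_k(\Gamma_0(4N),\chi)$ be the space of holomorphic $f:\mathbb H\to\mathbb C$ with $f|_k\gamma^*=\chi(\gamma)f$ for all $\gamma\in\Gamma_0(4N)$ that vanish at all cusps. * For $\ell\ge 1$ put $(f|_kV_\ell)(z)=f(\ell z)$. * For $N\mid M$ put $f|_k\mathrm{tr}^M_N=\frac1{(\Gamma_0(4N):\Gamma_0(4M))}\sum_i\overline{\chi(\alpha_i)}\,f|_k\alpha_i^*$, where $\Gamma_0(4N)=\bigsqcup_i\Gamma_0(4M)\alpha_i$. * For $\xi\in\mathfrak G$ lying over a matrix of determinant $m^2$, let the double coset of $\xi$ act by $f\mapsto (m^2)^{k/2-1}\sum_\nu\overline{\chi(\xi_\nu)}\,f|_k\xi_\nu$, where $\Delta_0(4N)\,\xi\,\Delta_0(4N)=\bigsqcup_\nu\Delta_0(4N)\xi_\nu$ and $\chi(\gamma_1^*\xi\gamma_2^*)=\chi(\gamma_1)\chi(\gamma_2)$.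 Let $T(m^2)=T_{4N}(1,m^2)$ and $T^*_{4N}(m^2,1)$ be the operators obtained from $\xi=\left(\begin{pmatrix}1&0\\0&m^2\end{pmatrix},m^{1/2}\right)$ and $\xi=\left(\begin{pmatrix}m^2&0\\0&1\end{pmatrix},m^{-1/2}\right)$, respectively. * At level $4M$ let $\langle f,g\rangle=\frac1{(SL_2(\mathbb Z):\Gamma_0(4M))}\int_{\mathcal F}f(z)\overline{g(z)}\,y^{k-2}\,dx\,dy$, $\mathcal F$ a fundamental domain of $\Gamma_0(4M)$. Let $f\in S_k(\Gamma_0(4N),\chi)$. Then for every integer $d\ge1$ $$(\Gamma_0(4N):\Gamma_0(4Nd^2))\,(f|_kV_{d^2})|_k\mathrm{tr}^{Nd^2}_N=\frac1{d^{2(k-1)}}\,f|_kT^*_{4N}(d^2,1).$$ If $p$ is a prime with $p\nmid 4N$ and $f|_kT(p^2)=\lambda_pf$ with $\lambda_p\in\mathbb C$, then $$(p^2+p)\,(f|_kV_{p^2})|_k\mathrm{tr}^{Np^2}_N=\frac{\overline{\lambda_p}}{p^{2(k-1)}}\,f,$$ where $\overline{\lambda_p}$ may be replaced by $\lambda_p$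 if $\chi(p)^2=1$, and $$\langle f,f|_kV_{p^2}\rangle=\frac{\lambda_p}{(p^2+p)\,p^{2(k-1)}}\,\langle f,f\rangle,$$ where the product on the left is taken at level $4Np^2$ and the one on the right at level $4N$. -/

import Mathlib

open UpperHalfPlane CongruenceSubgroup
open scoped MatrixGroups Manifold ComplexConjugate

noncomputable section

namespace HalfIntegral

/-- The weight `k = κ + 1/2`. -/
def weight (κ : ℕ) : ℝ := (κ : ℝ) + 1 / 2

/-! ### The covering group of `GL₂⁺(ℝ)` -/

/-- Shimura's covering group `𝔊` of `GL₂⁺(ℝ)`: pairs `(α, φ)` with `α = (a b; c d)` of positive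
determinant and `φ` holomorphic on `ℍ` with `φ(z)² = t · det(α)^(-1/2) · (c z + d)`
for some constant `t` with `|t| = 1`. -/
@[ext]
structure Cover where
  /-- the matrix `α` -/
  mat : GL (Fin 2) ℝ
  /-- the function `φ` -/
  fac : ℍ → ℂ
  det_pos : 0 < mat.det.val
  holo : MDifferentiable 𝓘(ℂ) 𝓘(ℂ) fac
  sq : ∃ t : ℂ, ‖t‖ = 1 ∧ ∀ z : ℍ,
    fac z ^ 2 = t * ((Real.sqrt mat.det.val : ℝ) : ℂ)⁻¹ * denom mat z

namespace Cover

lemma fac_ne_zero (x : Cover) (z : ℍ) : x.fac z ≠ 0 := by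
  obtain ⟨t, ht, h⟩ := x.sq
  have h0 : t ≠ 0 := by
    rintro rfl
    simp at ht
  have h1 : ((Real.sqrt x.mat.det.val : ℝ) : ℂ) ≠ 0 :=
    Complex.ofReal_ne_zero.mpr (Real.sqrt_pos.mpr x.det_pos).ne'
  intro hz
  have h2 := h z
  rw [hz] at h2
  exact mul_ne_zero (mul_ne_zero h0 (inv_ne_zero h1)) (denom_ne_zero x.mat z) (by
    rw [← h2]; simp)

lemma denom_mul (x y : GL (Fin 2) ℝ) (hy : 0 < y.det.val) (z : ℍ) :
    denom (x * y) z = denom x (y • z : ℍ) * denom y z := by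
  rw [denom_cocycle_σ]
  simp only [σ, if_pos hy, ContinuousAlgEquiv.refl_apply]

/-- The product `(α, φ(z)) (β, ψ(z)) = (α β, φ(β z) ψ(z))`. -/
instance : Mul Cover where
  mul x y :=
    { mat := x.mat * y.mat
      fac := fun z => x.fac (y.mat • z) * y.fac z
      det_pos := by
        have := mul_pos x.det_pos y.det_pos
        simpa using this
      holo := (x.holo.comp (mdifferentiable_smul y.det_pos)).mul y.holo
      sq := by
        obtain ⟨t, ht, h⟩ := x.sq
        obtain ⟨u, hu, h'⟩ := y.sq
        refine ⟨t * u, by rw [norm_mul, ht, hu, one_mul], fun z => ?_⟩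
        rw [mul_pow, h, h', denom_mul _ _ y.det_pos, map_mul, Units.val_mul,
          Real.sqrt_mul x.det_pos.le, Complex.ofReal_mul, mul_inv]
        ring }

instance : One Cover where
  one :=
    { mat := 1
      fac := fun _ => 1
      det_pos := by simp
      holo := mdifferentiable_const
      sq := ⟨1, by simp, fun z => by simp⟩ }

/-- The inverse `(α, φ(z))⁻¹ = (α⁻¹, φ(α⁻¹ z)⁻¹)`. -/
instance : Inv Cover where
  inv x :=
    have hpos : 0 < (x.mat⁻¹).det.val := by
      have := inv_pos.mpr x.det_pos
      rw [map_inv]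
      simpa using this
    { mat := x.mat⁻¹
      fac := fun z => (x.fac (x.mat⁻¹ • z))⁻¹
      det_pos := hpos
      holo := by
        have h1 := x.holo.comp (mdifferentiable_smul hpos)
        intro z
        have h2 : DifferentiableAt ℂ (fun w : ℂ => w⁻¹) (x.fac (x.mat⁻¹ • z)) :=
          differentiableAt_inv (x.fac_ne_zero _)
        exact h2.mdifferentiableAt.comp z (h1 z)
      sq := by
        obtain ⟨t, ht, h⟩ := x.sq
        refine ⟨t⁻¹, by rw [norm_inv, ht, inv_one], fun z => ?_⟩
        have h1 : denom x.mat (x.mat⁻¹ • z : ℍ) * denom x.mat⁻¹ z = 1 := by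
          rw [← denom_mul _ _ hpos, mul_inv_cancel, denom_one]
        rw [inv_pow, h, map_inv, Units.val_inv_eq_inv_val, Real.sqrt_inv,
          eq_inv_of_mul_eq_one_right h1]
        simp [mul_comm] }

lemma mul_mat (x y : Cover) : (x * y).mat = x.mat * y.mat := rfl
lemma mul_fac (x y : Cover) (z : ℍ) : (x * y).fac z = x.fac (y.mat • z) * y.fac z := rfl
lemma one_mat : (1 : Cover).mat = 1 := rfl
lemma one_fac (z : ℍ) : (1 : Cover).fac z = 1 := rfl
lemma inv_mat (x : Cover) : (x⁻¹).mat = x.mat⁻¹ := rfl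
lemma inv_fac (x : Cover) (z : ℍ) : (x⁻¹).fac z = (x.fac (x.mat⁻¹ • z))⁻¹ := rfl

instance : Group Cover :=
  Group.ofLeftAxioms
    (fun x y z => by
      ext1
      · simp only [mul_mat, mul_assoc]
      · funext w
        simp only [mul_fac, mul_mat, mul_smul, mul_assoc])
    (fun x => by
      ext1
      · simp only [mul_mat, one_mat, one_mul]
      · funext w
        simp only [mul_fac, one_fac, one_mul])
    (fun x => by
      ext1
      · simp only [mul_mat, inv_mat, one_mat, inv_mul_cancel]
      · funext w
        simp only [mul_fac, inv_fac, one_fac, inv_smul_smul]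
        exact inv_mul_cancel₀ (x.fac_ne_zero w))

end Cover

/-- The action `f|_k (α, φ) (z) = f(α z) φ(z)^(-2k)`, where `2k = 2κ + 1`. -/
def slash (κ : ℕ) (f : ℍ → ℂ) (x : Cover) : ℍ → ℂ :=
  fun z => f (x.mat • z) * (x.fac z ^ (2 * κ + 1))⁻¹

/-! ### The theta multiplier and the embedding of `Γ₀(4)` -/

/-- Shimura's quadratic residue symbol `(c/d)` for odd `d`: the Jacobi symbol `(c/|d|)`, times `-1`
if both `c` and `d` are negative. In particular `(0/±1) = 1`. -/
def quadSymbol (c d : ℤ) : ℤ :=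
  (if c < 0 ∧ d < 0 then -1 else 1) * jacobiSym c d.natAbs

/-- `ε_d`, for odd `d`: it is `1` if `d ≡ 1 mod 4` and `i` if `d ≡ 3 mod 4`. -/
def eps (d : ℤ) : ℂ := if d % 4 = 1 then 1 else Complex.I

/-- The theta multiplier `j(γ, z) = ε_d⁻¹ (c/d) (c z + d)^(1/2) = θ(γ z)/θ(z)` of
`γ = (a b; c d) ∈ Γ₀(4)`; the square root has argument in `(-π/2, π/2]`. -/
def thetaFactor (γ : SL(2, ℤ)) (z : ℍ) : ℂ :=
  (eps (γ 1 1))⁻¹ * (quadSymbol (γ 1 0) (γ 1 1) : ℂ) *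
    (((γ 1 0 : ℤ) : ℂ) * (z : ℂ) + ((γ 1 1 : ℤ) : ℂ)) ^ (1 / 2 : ℂ)

lemma quadSymbol_sq (γ : SL(2, ℤ)) : quadSymbol (γ 1 0) (γ 1 1) ^ 2 = 1 := by
  have hdet : γ 0 0 * γ 1 1 - γ 0 1 * γ 1 0 = 1 := by
    have := γ.det_coe
    rwa [Matrix.det_fin_two] at this
  have hco : IsCoprime (γ 1 0) (γ 1 1) := ⟨-γ 0 1, γ 0 0, by linarith⟩
  have hg : (γ 1 0).gcd ((γ 1 1).natAbs : ℤ) = 1 := by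
    rw [Int.isCoprime_iff_gcd_eq_one] at hco
    simpa only [Int.gcd, Int.natAbs_natCast] using hco
  rw [quadSymbol, mul_pow, jacobiSym.sq_one hg]
  split_ifs <;> norm_num

lemma holo_sqrt (c d : ℤ) (h : c ≠ 0 ∨ d ≠ 0) :
    MDifferentiable 𝓘(ℂ) 𝓘(ℂ)
      (fun z : ℍ => ((c : ℂ) * (z : ℂ) + (d : ℂ)) ^ (1 / 2 : ℂ)) := by
  by_cases hc : c = 0
  · subst hc
    simpa using (mdifferentiable_const (c := ((d : ℂ) ^ (1 / 2 : ℂ))))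
  · rw [UpperHalfPlane.mdifferentiable_iff]
    have key : DifferentiableOn ℂ (fun w : ℂ => ((c : ℂ) * w + (d : ℂ)) ^ (1 / 2 : ℂ))
        {w : ℂ | 0 < w.im} := by
      intro w hw
      refine DifferentiableAt.differentiableWithinAt ?_
      refine DifferentiableAt.cpow_const (by fun_prop) ?_
      refine Complex.mem_slitPlane_iff.mpr (Or.inr ?_)
      have hw' : w.im ≠ 0 := ne_of_gt hw
      simp [hc, hw']
    refine key.congr fun w hw => ?_
    simp [Function.comp, UpperHalfPlane.ofComplex_apply_of_im_pos hw]

/-- The embedding `γ ↦ γ* = (γ, j(γ, z))` of `Γ₀(4)` into the covering group. -/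
def lift (γ : Gamma0 4) : Cover where
  mat := Matrix.SpecialLinearGroup.mapGL ℝ (γ : SL(2, ℤ))
  fac := thetaFactor (γ : SL(2, ℤ))
  det_pos := by simp
  holo := by
    have h : (γ : SL(2, ℤ)) 1 0 ≠ 0 ∨ (γ : SL(2, ℤ)) 1 1 ≠ 0 := by
      by_contra hcon
      push Not at hcon
      have := (γ : SL(2, ℤ)).det_coe
      rw [Matrix.det_fin_two] at this
      simp [hcon.1, hcon.2] at this
    exact (mdifferentiable_const (c := (eps ((γ : SL(2, ℤ)) 1 1))⁻¹ *
      (quadSymbol ((γ : SL(2, ℤ)) 1 0) ((γ : SL(2, ℤ)) 1 1) : ℂ))).mul (holo_sqrt _ _ h)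
  sq := by
    refine ⟨((eps ((γ : SL(2, ℤ)) 1 1))⁻¹) ^ 2, ?_, fun z => ?_⟩
    · rw [eps]
      split_ifs <;> simp
    · have hq : ((quadSymbol ((γ : SL(2, ℤ)) 1 0) ((γ : SL(2, ℤ)) 1 1) : ℤ) : ℂ) ^ 2 = 1 := by
        exact_mod_cast quadSymbol_sq (γ : SL(2, ℤ))
      rw [thetaFactor, mul_pow, mul_pow, hq, ← Complex.cpow_nat_mul]
      simp [denom]

/-- The inclusion `Γ₀(4N) ⊆ Γ₀(4)`. -/
lemma Gamma0_le_four (N : ℕ) : Gamma0 (4 * N) ≤ Gamma0 4 := by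
  intro γ hγ
  rw [Gamma0_mem, ZMod.intCast_zmod_eq_zero_iff_dvd] at hγ ⊢
  exact dvd_trans ⟨(N : ℤ), by push_cast; ring⟩ hγ

/-- `γ ↦ γ*` on `Γ₀(4N)`; its image is `Δ₀(4N)`. -/
def toDelta {N : ℕ} (γ : Gamma0 (4 * N)) : Cover := lift (Subgroup.inclusion (Gamma0_le_four N) γ)

/-- The character `(a b; c d) ↦ χ(d)` of `Γ₀(4N)`. -/
def charGamma {N : ℕ} (χ : DirichletCharacter ℂ (4 * N)) (γ : Gamma0 (4 * N)) : ℂ :=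
  χ (((γ : SL(2, ℤ)) 1 1 : ℤ) : ZMod (4 * N))

/-! ### Cusp forms -/

/-- `f` is a cusp form of weight `κ + 1/2` and character `χ` for `Γ₀(4N)`. -/
structure IsCuspForm (κ : ℕ) {N : ℕ} (χ : DirichletCharacter ℂ (4 * N)) (f : ℍ → ℂ) : Prop where
  holo : MDifferentiable 𝓘(ℂ) 𝓘(ℂ) f
  slash_eq : ∀ γ : Gamma0 (4 * N), slash κ f (toDelta γ) = charGamma χ γ • f
  /-- vanishing at the cusp `σ(∞)`, for every `σ ∈ SL₂(ℤ)` and every lift of `σ` -/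
  zero_at_cusps : ∀ (σ : SL(2, ℤ)) (x : Cover), x.mat = Matrix.SpecialLinearGroup.mapGL ℝ σ →
    IsZeroAtImInfty (slash κ f x)

/-- A fundamental domain for `Γ₀(4N)` acting on `ℍ`: the union of the translates `αᵢ 𝒟` of the
standard fundamental domain of `SL₂(ℤ)`, where `SL₂(ℤ)` is the disjoint union of the
cosets `Γ₀(4N) αᵢ`. -/
def fundDomain (N : ℕ) : Set ℍ :=
  ⋃ q : Quotient (QuotientGroup.rightRel (Gamma0 (4 * N))),
    (fun z : ℍ => (Quotient.out q : SL(2, ℤ)) • z) '' ModularGroup.fd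

/-- The normalized Petersson product
`(SL₂(ℤ) : Γ₀(4N))⁻¹ ∫ f(z) conj(g(z)) y^(k-2) dx dy` over a fundamental domain of `Γ₀(4N)`;
the measure `volume` on `ℍ` is `y^(-2) dx dy`. -/
def petersson (κ N : ℕ) (f g : ℍ → ℂ) : ℂ :=
  ((Gamma0 (4 * N)).index : ℂ)⁻¹ *
    ∫ z in fundDomain N, f z * conj (g z) * ((z.im ^ weight κ : ℝ) : ℂ)

/-! ### The operators -/

/-- `f|V_ℓ (z) = f(ℓ z)`. -/
def V (ℓ : ℕ) (hℓ : 0 < ℓ) (f : ℍ → ℂ) : ℍ → ℂ :=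
  fun z => f ⟨(ℓ : ℂ) * (z : ℂ), by simpa using mul_pos (Nat.cast_pos.mpr hℓ) z.im_pos⟩

/-- The index `(Γ₀(4N) : Γ₀(4M))`, for `N ∣ M`. -/
def levelIndex (N M : ℕ) : ℕ := (Gamma0 (4 * M)).relIndex (Gamma0 (4 * N))

/-- The trace operator from level `4M` to level `4N`, for `N ∣ M`:
`f|tr = (Γ₀(4N) : Γ₀(4M))⁻¹ ∑ᵢ conj(χ(αᵢ)) f|_k αᵢ*`, where `Γ₀(4N)` is the disjoint union of
the cosets `Γ₀(4M) αᵢ`. -/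
def trace (κ N M : ℕ) (χ : DirichletCharacter ℂ (4 * N)) (f : ℍ → ℂ) : ℍ → ℂ :=
  (levelIndex N M : ℂ)⁻¹ •
    ∑ᶠ q : Quotient (QuotientGroup.rightRel ((Gamma0 (4 * M)).subgroupOf (Gamma0 (4 * N)))),
      conj (charGamma χ (Quotient.out q)) • slash κ f (toDelta (Quotient.out q))

/-- The double coset `Δ₀(4N) ξ Δ₀(4N)`. -/
def doubleCosetSet (N : ℕ) (ξ : Cover) : Set Cover :=
  {x | ∃ γ : Gamma0 (4 * N) × Gamma0 (4 * N), x = toDelta γ.1 * ξ * toDelta γ.2}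

/-- Two elements of the double coset lie in the same coset `Δ₀(4N) x`. -/
def SameCoset (N : ℕ) (ξ : Cover) (x y : doubleCosetSet N ξ) : Prop :=
  ∃ γ : Gamma0 (4 * N), (y : Cover) = toDelta γ * (x : Cover)

/-- The extension of `χ` to the double coset, `χ(γ₁* ξ γ₂*) = χ(γ₁) χ(γ₂)`. -/
def charDouble {N : ℕ} (χ : DirichletCharacter ℂ (4 * N)) {ξ : Cover} (x : doubleCosetSet N ξ) : ℂ :=
  charGamma χ (Classical.choose x.2).1 * charGamma χ (Classical.choose x.2).2

/-- The action of the double coset of `ξ` on forms of weight `k = κ + 1/2` and character `χ`: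
`det(ξ)^(k/2 - 1) ∑_ν conj(χ(ξ_ν)) f|_k ξ_ν`, where `Δ₀(4N) ξ Δ₀(4N)` is the disjoint union of the
cosets `Δ₀(4N) ξ_ν`. -/
def heckeOp (κ : ℕ) {N : ℕ} (χ : DirichletCharacter ℂ (4 * N)) (ξ : Cover) (f : ℍ → ℂ) : ℍ → ℂ :=
  ((ξ.mat.det.val ^ (weight κ / 2 - 1) : ℝ) : ℂ) •
    ∑ᶠ q : Quot (SameCoset N ξ), conj (charDouble χ (Quot.out q)) •
      slash κ f ((Quot.out q : doubleCosetSet N ξ) : Cover)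

/-- The element `((1 0; 0 m²), m^(1/2))` of the covering group. -/
def xi (m : ℕ) (hm : 0 < m) : Cover where
  mat := Matrix.GeneralLinearGroup.mkOfDetNeZero !![1, 0; 0, (m : ℝ) ^ 2] (by simp [hm.ne'])
  fac := fun _ => ((Real.sqrt m : ℝ) : ℂ)
  det_pos := by
    have : (0 : ℝ) < m := Nat.cast_pos.mpr hm
    simp [Matrix.GeneralLinearGroup.mkOfDetNeZero, hm]
  holo := mdifferentiable_const
  sq := by
    have h0 : (m : ℂ) ≠ 0 := by exact_mod_cast hm.ne'
    refine ⟨1, by simp, fun z => ?_⟩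
    rw [← Complex.ofReal_pow, Real.sq_sqrt (Nat.cast_nonneg m)]
    simp [Matrix.GeneralLinearGroup.mkOfDetNeZero, denom]
    field_simp

/-- The element `((m² 0; 0 1), m^(-1/2))` of the covering group. -/
def xiStar (m : ℕ) (hm : 0 < m) : Cover where
  mat := Matrix.GeneralLinearGroup.mkOfDetNeZero !![(m : ℝ) ^ 2, 0; 0, 1] (by simp [hm.ne'])
  fac := fun _ => ((Real.sqrt m : ℝ) : ℂ)⁻¹
  det_pos := by
    have : (0 : ℝ) < m := Nat.cast_pos.mpr hm
    simp [Matrix.GeneralLinearGroup.mkOfDetNeZero, hm]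
  holo := mdifferentiable_const
  sq := by
    refine ⟨1, by simp, fun z => ?_⟩
    rw [inv_pow, ← Complex.ofReal_pow, Real.sq_sqrt (Nat.cast_nonneg m)]
    simp [Matrix.GeneralLinearGroup.mkOfDetNeZero, denom]

/-- The Hecke operator `T(m²) = T_{4N}(1, m²)`. -/
def heckeT (κ : ℕ) {N : ℕ} (χ : DirichletCharacter ℂ (4 * N)) (m : ℕ) (hm : 0 < m) :
    (ℍ → ℂ) → (ℍ → ℂ) := heckeOp κ χ (xi m hm)

/-- The Hecke operator `T*_{4N}(m², 1)`. -/
def heckeTStar (κ : ℕ) {N : ℕ} (χ : DirichletCharacter ℂ (4 * N)) (m : ℕ) (hm : 0 < m) :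
    (ℍ → ℂ) → (ℍ → ℂ) := heckeOp κ χ (xiStar m hm)

end HalfIntegral

end

noncomputable section

namespace HalfIntegral

/-! ### The slash action -/

section slash

variable (κ : ℕ)

/-! Write `ξ` and `ξ*` for the elements `xi` and `xiStar` of the covering group. The operator of a
double coset is a sum over `K \ Γ₀(4N)`, where `K` consists of the `γ` whose lift fixes the coset of
`ξ` under right multiplication (`heckeOp_eq_cosetSum`). For `ξ*` over `(d² 0; 0 1)` this `K` is
`Γ₀(4Nd²)`, and `f|ξ*` is `d^k f|V`. Hence `T*` is, up to a power of `d`, the unnormalized trace of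
`f|V`, which is the first identity (`levelIndex_smul_trace_V`).

For a prime `p ∤ 4N` two relations between `T` and `T*` are combined. Swap: explicit `δ, τ ∈ Γ₀(4N)`
satisfy `δ* ξ* = ξ τ*`, so the two coset sums differ only by the factor `c = χ(τ)`, with `χ(p)² c =
1` (`exists_cosetSum_lower_eq_upper`). Thus an eigenform of `T` is one of `T*`. Adjointness: the
integral of `f · conj(f|ξ*) · y^k` at level `4Np²` unfolds directly to a pairing of `f` with its
`T*` sum, and after the substitution `z ↦ p² z` to a pairing of its `T` sum with `f`
(`setIntegral_integrand_eq_lower`, `setIntegral_integrand_eq_upper`). As the integral of `|f|² y^k`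
is nonzero, the `T*` eigenvalue is the conjugate of the `T` eigenvalue, and if `χ(p)² = 1` the two
coincide. The same integral is the required Petersson product.

That `γ ↦ γ*` is a homomorphism is not derived from theta functions: it holds up to sign because the
squares of the multipliers satisfy the cocycle relation, and a nonzero form with odd `2k` excludes
the minus sign (`IsCuspForm.toDelta_mul`). The case `f = 0` is trivial and is split off where
needed. -/

lemma slash_mul (f : ℍ → ℂ) (x y : Cover) : slash κ f (x * y) = slash κ (slash κ f x) y := by
  funext z
  simp only [slash, Cover.mul_mat, Cover.mul_fac, mul_smul, mul_pow, mul_inv, mul_assoc]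

lemma slash_smul (c : ℂ) (f : ℍ → ℂ) (x : Cover) : slash κ (c • f) x = c • slash κ f x := by
  funext z
  simp [slash, mul_assoc]

lemma slash_zero (x : Cover) : slash κ 0 x = 0 := by
  funext z
  simp [slash]

end slash

/-! ### The character -/

section charGamma

variable {N : ℕ} (χ : DirichletCharacter ℂ (4 * N))

lemma isUnit_lower_right (γ : Gamma0 (4 * N)) :
    IsUnit ((((γ : SL(2, ℤ)) 1 1 : ℤ) : ZMod (4 * N))) := by
  have hdet : (γ : SL(2, ℤ)) 0 0 * (γ : SL(2, ℤ)) 1 1 - (γ : SL(2, ℤ)) 0 1 * (γ : SL(2, ℤ)) 1 0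
      = 1 := by
    have := (γ : SL(2, ℤ)).det_coe
    rwa [Matrix.det_fin_two] at this
  have h := congrArg (Int.cast : ℤ → ZMod (4 * N)) hdet
  have h0 := Gamma0_mem.mp γ.2
  push_cast at h
  rw [h0, mul_zero, sub_zero] at h
  exact IsUnit.of_mul_eq_one _ ((mul_comm _ _).trans h)

lemma norm_charGamma (γ : Gamma0 (4 * N)) : ‖charGamma χ γ‖ = 1 := by
  obtain ⟨u, hu⟩ := isUnit_lower_right γ
  rw [charGamma, ← hu]
  exact DirichletCharacter.unit_norm_eq_one χ u

lemma charGamma_mul (α β : Gamma0 (4 * N)) :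
    charGamma χ (α * β) = charGamma χ α * charGamma χ β := by
  rw [charGamma, charGamma, charGamma, ← map_mul]
  congr 1
  exact map_mul (Gamma0Map (4 * N)) α β

lemma conj_mul_charGamma (γ : Gamma0 (4 * N)) : conj (charGamma χ γ) * charGamma χ γ = 1 := by
  rw [mul_comm, Complex.mul_conj, Complex.normSq_eq_norm_sq, norm_charGamma]
  simp

lemma charGamma_ne_zero (γ : Gamma0 (4 * N)) : charGamma χ γ ≠ 0 := by
  rw [← norm_ne_zero_iff, norm_charGamma]
  exact one_ne_zero

end charGamma

/-! ### The theta multiplier is an automorphy factor -/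

lemma thetaFactor_sq (γ : SL(2, ℤ)) (z : ℍ) :
    thetaFactor γ z ^ 2 = (eps (γ 1 1))⁻¹ ^ 2 *
      denom (Matrix.SpecialLinearGroup.mapGL ℝ γ) z := by
  have hq : ((quadSymbol (γ 1 0) (γ 1 1) : ℤ) : ℂ) ^ 2 = 1 := by
    exact_mod_cast quadSymbol_sq γ
  rw [thetaFactor, mul_pow, mul_pow, hq, ← Complex.cpow_nat_mul]
  simp [denom]

/-- The square of `eps` is the nontrivial character modulo 4, which is all that survives of the
theta multiplier after squaring. -/
lemma eps_sq_mul {a b c : ℤ} (ha : a % 2 = 1) (hb : b % 2 = 1) (h : c % 4 = (a * b) % 4) :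
    eps c ^ 2 = eps a ^ 2 * eps b ^ 2 := by
  have ha' : a % 4 = 1 ∨ a % 4 = 3 := by omega
  have hb' : b % 4 = 1 ∨ b % 4 = 3 := by omega
  rcases ha' with ha' | ha' <;> rcases hb' with hb' | hb' <;>
    simp [eps, h, Int.mul_emod, ha', hb']

lemma four_dvd_lower_left (γ : Gamma0 4) : (4 : ℤ) ∣ (γ : SL(2, ℤ)) 1 0 := by
  have h := Gamma0_mem.mp γ.2
  rw [ZMod.intCast_zmod_eq_zero_iff_dvd] at h
  exact_mod_cast h

lemma lower_right_odd (γ : Gamma0 4) : (γ : SL(2, ℤ)) 1 1 % 2 = 1 := by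
  have hdet : (γ : SL(2, ℤ)) 0 0 * (γ : SL(2, ℤ)) 1 1 - (γ : SL(2, ℤ)) 0 1 * (γ : SL(2, ℤ)) 1 0
      = 1 := by
    have := (γ : SL(2, ℤ)).det_coe
    rwa [Matrix.det_fin_two] at this
  obtain ⟨t, ht⟩ := four_dvd_lower_left γ
  by_contra h
  obtain ⟨s, hs⟩ : (2 : ℤ) ∣ (γ : SL(2, ℤ)) 1 1 := by omega
  rw [ht, hs] at hdet
  have : 2 * ((γ : SL(2, ℤ)) 0 0 * s - (γ : SL(2, ℤ)) 0 1 * (2 * t)) = 1 := by linarith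
  omega

lemma mul_lower_right (α β : SL(2, ℤ)) : (α * β) 1 1 = α 1 0 * β 0 1 + α 1 1 * β 1 1 := by
  rw [Matrix.SpecialLinearGroup.coe_mul, Matrix.mul_apply, Fin.sum_univ_two]

/-- Squaring removes the quadratic symbols, so no reciprocity law is needed: what remains is the
cocycle relation of `denom` and a character modulo 4. -/
lemma lift_mul_fac_sq (α β : Gamma0 4) (z : ℍ) :
    (lift (α * β)).fac z ^ 2 = ((lift α).fac ((lift β).mat • z) * (lift β).fac z) ^ 2 := by
  obtain ⟨α, hα⟩ := α
  obtain ⟨β, hβ⟩ := β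
  have hpos : 0 < (Matrix.SpecialLinearGroup.mapGL ℝ β).det.val := (lift ⟨β, hβ⟩).det_pos
  have heps : eps ((α * β) 1 1) ^ 2 = eps (α 1 1) ^ 2 * eps (β 1 1) ^ 2 :=
    eps_sq_mul (lower_right_odd ⟨α, hα⟩) (lower_right_odd ⟨β, hβ⟩) (by
      obtain ⟨t, ht⟩ := four_dvd_lower_left ⟨α, hα⟩
      dsimp only at ht
      rw [mul_lower_right, ht, mul_assoc, Int.add_emod, Int.mul_emod_right]
      simp)
  change thetaFactor (α * β) z ^ 2 = (thetaFactor α _ * thetaFactor β z) ^ 2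
  rw [mul_pow, thetaFactor_sq, thetaFactor_sq, thetaFactor_sq, map_mul, Cover.denom_mul _ _ hpos,
    inv_pow, heps, mul_inv, inv_pow, inv_pow]
  change _ = _ * denom (Matrix.SpecialLinearGroup.mapGL ℝ α)
    (Matrix.SpecialLinearGroup.mapGL ℝ β • z : ℍ) * _
  ring

lemma Cover.continuous_fac (x : Cover) : Continuous x.fac := x.holo.continuous

lemma toDelta_mul_mat {N : ℕ} (α β : Gamma0 (4 * N)) :
    (toDelta (α * β)).mat = (toDelta α * toDelta β).mat :=
  map_mul (Matrix.SpecialLinearGroup.mapGL ℝ) (α : SL(2, ℤ)) (β : SL(2, ℤ))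

lemma toDelta_mul_fac_sq {N : ℕ} (α β : Gamma0 (4 * N)) (z : ℍ) :
    (toDelta (α * β)).fac z ^ 2 = (toDelta α * toDelta β).fac z ^ 2 := by
  rw [toDelta, map_mul, Cover.mul_fac]
  exact lift_mul_fac_sq _ _ z

/-- Two continuous functions on the connected set `ℍ` with equal squares, one of them nowhere zero,
agree up to one global sign. -/
lemma toDelta_mul_fac_eq_or_neg {N : ℕ} (α β : Gamma0 (4 * N)) :
    (toDelta (α * β)).fac = (toDelta α * toDelta β).fac ∨
      (toDelta (α * β)).fac = -(toDelta α * toDelta β).fac := by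
  have h1 := (toDelta (α * β)).continuous_fac
  have h2 := (toDelta α * toDelta β).continuous_fac
  have h3 := (toDelta α * toDelta β).fac_ne_zero
  have h4 := toDelta_mul_fac_sq α β
  generalize (toDelta (α * β)).fac = u at *
  generalize (toDelta α * toDelta β).fac = v at *
  rcases isPreconnected_univ.eq_or_eq_neg_of_sq_eq h1.continuousOn h2.continuousOn
    (fun w _ => h4 w) (fun _ => h3 _) with h | h
  · exact Or.inl (funext fun w => h (Set.mem_univ w))
  · exact Or.inr (funext fun w => h (Set.mem_univ w))

/-- A nonzero form of half-integral weight forces `γ ↦ γ*` to be multiplicative on its level. -/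
theorem IsCuspForm.toDelta_mul {κ N : ℕ} {χ : DirichletCharacter ℂ (4 * N)} {f : ℍ → ℂ}
    (hf : IsCuspForm κ χ f) (h0 : f ≠ 0) (α β : Gamma0 (4 * N)) :
    toDelta (α * β) = toDelta α * toDelta β := by
  have hmat := toDelta_mul_mat α β
  obtain ⟨z, hz⟩ := Function.ne_iff.mp h0
  rcases toDelta_mul_fac_eq_or_neg α β with h | h
  · exact Cover.ext hmat h
  · exfalso
    -- Both elements multiply `f` by `χ(αβ)`. With the minus sign, the odd power `φ^(2κ+1)` would
    -- make this common nonzero value its own negative.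
    have h1 : slash κ f (toDelta (α * β)) z = slash κ f (toDelta α * toDelta β) z := by
      rw [slash_mul, hf.slash_eq, hf.slash_eq, slash_smul, hf.slash_eq, charGamma_mul, smul_smul]
    have h3 := congrFun (hf.slash_eq (α * β)) z
    have h4 := (toDelta α * toDelta β).fac_ne_zero z
    have h5 := mul_ne_zero (charGamma_ne_zero χ (α * β)) hz
    rw [Pi.smul_apply, smul_eq_mul] at h3
    rw [← h3] at h5
    refine h5 (self_eq_neg.mp ?_)
    have hodd : Odd (2 * κ + 1) := ⟨κ, rfl⟩
    conv_rhs => rw [h1]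
    rw [slash, slash, hmat, h, Pi.neg_apply, hodd.neg_pow, inv_neg, mul_neg]

/-! ### Sums over cosets -/

/-- The sum `∑ conj(χ(γ)) g|_k γ*` over representatives of the cosets `K γ` in `Γ₀(4N)`. -/
def cosetSum (κ : ℕ) {N : ℕ} (χ : DirichletCharacter ℂ (4 * N)) (K : Subgroup (Gamma0 (4 * N)))
    (g : ℍ → ℂ) : ℍ → ℂ :=
  ∑ᶠ q : Quotient (QuotientGroup.rightRel K),
    conj (charGamma χ (Quotient.out q)) • slash κ g (toDelta (Quotient.out q))

lemma trace_eq_cosetSum (κ N M : ℕ) (χ : DirichletCharacter ℂ (4 * N)) (g : ℍ → ℂ) :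
    trace κ N M χ g =
      (levelIndex N M : ℂ)⁻¹ • cosetSum κ χ ((Gamma0 (4 * M)).subgroupOf (Gamma0 (4 * N))) g :=
  rfl

section Hecke

variable {κ N : ℕ} {χ : DirichletCharacter ℂ (4 * N)} {f : ℍ → ℂ}

lemma toDelta_one_of_mul (hΔ : ∀ α β : Gamma0 (4 * N), toDelta (α * β) = toDelta α * toDelta β) :
    toDelta (1 : Gamma0 (4 * N)) = 1 :=
  mul_eq_left.mp ((hΔ 1 1).symm.trans (by rw [mul_one]))

lemma toDelta_inv_of_mul (hΔ : ∀ α β : Gamma0 (4 * N), toDelta (α * β) = toDelta α * toDelta β)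
    (α : Gamma0 (4 * N)) : toDelta α⁻¹ = (toDelta α)⁻¹ := by
  refine eq_inv_of_mul_eq_one_left ?_
  rw [← hΔ, inv_mul_cancel, toDelta_one_of_mul hΔ]

/-- The summand of `cosetSum` does not depend on the representative of `K γ`, provided `g`
transforms under `K` by `χ`. -/
lemma coset_term_mul (hΔ : ∀ α β : Gamma0 (4 * N), toDelta (α * β) = toDelta α * toDelta β)
    {g : ℍ → ℂ} {k : Gamma0 (4 * N)} (hk : slash κ g (toDelta k) = charGamma χ k • g)
    (γ : Gamma0 (4 * N)) :
    conj (charGamma χ (k * γ)) • slash κ g (toDelta (k * γ)) =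
      conj (charGamma χ γ) • slash κ g (toDelta γ) := by
  rw [hΔ, slash_mul, hk, slash_smul, charGamma_mul, map_mul, smul_smul, mul_right_comm,
    conj_mul_charGamma, one_mul]

lemma slash_slash_of_commute (hf : IsCuspForm κ χ f) {ξ : Cover} {γ γ' : Gamma0 (4 * N)}
    (h : ξ * toDelta γ = toDelta γ' * ξ) :
    slash κ (slash κ f ξ) (toDelta γ) = charGamma χ γ' • slash κ f ξ := by
  rw [← slash_mul, h, slash_mul, hf.slash_eq, slash_smul]

lemma sameCoset_equivalence
    (hΔ : ∀ α β : Gamma0 (4 * N), toDelta (α * β) = toDelta α * toDelta β) (ξ : Cover) :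
    Equivalence (SameCoset N ξ) where
  refl x := ⟨1, by rw [toDelta_one_of_mul hΔ, one_mul]⟩
  symm := by
    rintro x y ⟨γ, h⟩
    exact ⟨γ⁻¹, by rw [h, toDelta_inv_of_mul hΔ, inv_mul_cancel_left]⟩
  trans := by
    rintro x y z ⟨γ, h⟩ ⟨δ, h'⟩
    exact ⟨δ * γ, by rw [h', h, hΔ, mul_assoc]⟩

/-- The operator of the double coset of `ξ` is a sum over `K \ Γ₀(4N)`, where `K` is the
stabilizer of the coset `Δ₀(4N) ξ`. -/
theorem heckeOp_eq_cosetSum (hf : IsCuspForm κ χ f)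
    (hΔ : ∀ α β : Gamma0 (4 * N), toDelta (α * β) = toDelta α * toDelta β)
    (ξ : Cover) (K : Subgroup (Gamma0 (4 * N)))
    (hK : ∀ γ ∈ K, ∃ γ' : Gamma0 (4 * N), ξ * toDelta γ = toDelta γ' * ξ ∧ charGamma χ γ' = charGamma χ γ)
    (hK' : ∀ γ γ' : Gamma0 (4 * N), ξ * toDelta γ = toDelta γ' * ξ → γ ∈ K) :
    heckeOp κ χ ξ f = ((ξ.mat.det.val ^ (weight κ / 2 - 1) : ℝ) : ℂ) •
      cosetSum κ χ K (slash κ f ξ) := by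
  have hslash : ∀ k ∈ K, slash κ (slash κ f ξ) (toDelta k) = charGamma χ k • slash κ f ξ := by
    intro k hk
    obtain ⟨γ', h, h'⟩ := hK k hk
    rw [slash_slash_of_commute hf h, h']
  have hmem : ∀ γ : Gamma0 (4 * N), ξ * toDelta γ ∈ doubleCosetSet N ξ := fun γ =>
    ⟨(1, γ), by rw [toDelta_one_of_mul hΔ, one_mul]⟩
  have hrel : ∀ (γ₁ γ₂ δ : Gamma0 (4 * N)), ξ * toDelta γ₂ = toDelta δ * (ξ * toDelta γ₁) →
      γ₂ * γ₁⁻¹ ∈ K := by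
    intro γ₁ γ₂ δ h
    refine hK' _ δ ?_
    rw [hΔ, ← mul_assoc, h, toDelta_inv_of_mul hΔ, mul_assoc, mul_assoc, mul_inv_cancel, mul_one]
  have hexact : ∀ x y : doubleCosetSet N ξ, Quot.mk (SameCoset N ξ) x = Quot.mk _ y →
      SameCoset N ξ x y := fun x y h =>
    ((sameCoset_equivalence hΔ ξ).eqvGen_iff).mp (Quot.eqvGen_exact h)
  -- The bijection sends `K γ` to the coset `Δ₀(4N) ξ γ*`: `hK'` makes it injective, `hK`
  -- surjective.
  let e : Quotient (QuotientGroup.rightRel K) → Quot (SameCoset N ξ) := fun q =>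
    Quot.mk _ ⟨ξ * toDelta (Quotient.out q), hmem _⟩
  have he : Function.Bijective e := by
    constructor
    · intro q q' h
      obtain ⟨δ, hδ⟩ := hexact _ _ h
      rw [← Quotient.out_eq q, ← Quotient.out_eq q']
      exact Quotient.sound (QuotientGroup.rightRel_apply.mpr (hrel _ _ δ hδ))
    · intro Q
      obtain ⟨⟨x, ⟨γ₁, γ₂⟩, hx⟩, rfl⟩ := Quot.exists_rep Q
      refine ⟨Quotient.mk _ γ₂, Quot.sound ?_⟩
      have hout : (QuotientGroup.rightRel K) (Quotient.out (Quotient.mk _ γ₂)) γ₂ :=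
        Quotient.exact (Quotient.out_eq _)
      obtain ⟨γ', h, -⟩ := hK _ (QuotientGroup.rightRel_apply.mp hout)
      refine ⟨γ₁ * γ', ?_⟩
      dsimp only at hx ⊢
      rw [hx, hΔ, mul_assoc, mul_assoc, ← mul_assoc (toDelta γ'), ← h, mul_assoc, ← hΔ,
        inv_mul_cancel_right]
  rw [heckeOp, cosetSum]
  congr 1
  symm
  refine finsum_eq_of_bijective e he fun q => ?_
  set x := Quot.out (e q) with hx
  obtain ⟨δ, hδ⟩ := hexact ⟨ξ * toDelta (Quotient.out q), hmem _⟩ x (Quot.out_eq (e q)).symm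
  have hdec := Classical.choose_spec x.2
  rw [charDouble]
  set γ₁ := (Classical.choose x.2).1
  set γ₂ := (Classical.choose x.2).2
  -- In the chosen decomposition `x = γ₁* ξ γ₂*` the element `γ₂` must represent the class `q`. The
  -- contribution of `γ₁` then cancels against `charDouble`, so the arbitrary choices in its
  -- definition are harmless.
  have hk : γ₂ * (Quotient.out q)⁻¹ ∈ K := by
    refine hrel _ _ (γ₁⁻¹ * δ) ?_
    dsimp only at hδ
    rw [hΔ, mul_assoc, ← hδ, hdec, toDelta_inv_of_mul hΔ]
    group
  have hterm := coset_term_mul hΔ (hslash _ hk) (Quotient.out q)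
  rw [inv_mul_cancel_right] at hterm
  rw [← hterm, hdec, slash_mul, slash_mul, hf.slash_eq, slash_smul, slash_smul, smul_smul,
    map_mul, mul_right_comm, conj_mul_charGamma, one_mul]

end Hecke

/-! ### Conjugation by a dilation -/

lemma det_eq_one (γ : SL(2, ℤ)) : γ 0 0 * γ 1 1 - γ 0 1 * γ 1 0 = 1 := by
  have := γ.det_coe
  rwa [Matrix.det_fin_two] at this

/-- `γ' = (m² 0; 0 1) γ (m² 0; 0 1)⁻¹`. -/
structure IsDilate (m : ℕ) (γ γ' : SL(2, ℤ)) : Prop where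
  h00 : γ' 0 0 = γ 0 0
  h01 : γ' 0 1 = (m : ℤ) ^ 2 * γ 0 1
  h10 : γ 1 0 = (m : ℤ) ^ 2 * γ' 1 0
  h11 : γ' 1 1 = γ 1 1

lemma exists_isDilate_right (m : ℕ) (γ : SL(2, ℤ)) {c : ℤ} (h : γ 1 0 = (m : ℤ) ^ 2 * c) :
    ∃ γ', IsDilate m γ γ' ∧ γ' 1 0 = c :=
  ⟨⟨!![γ 0 0, (m : ℤ) ^ 2 * γ 0 1; c, γ 1 1], by
    rw [Matrix.det_fin_two_of]; linear_combination det_eq_one γ + γ 0 1 * h⟩, ⟨rfl, rfl, h, rfl⟩, rfl⟩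

lemma exists_isDilate_left (m : ℕ) (γ' : SL(2, ℤ)) (h : (m : ℤ) ^ 2 ∣ γ' 0 1) :
    ∃ γ, IsDilate m γ γ' := by
  obtain ⟨b, hb⟩ := h
  exact ⟨⟨!![γ' 0 0, b; (m : ℤ) ^ 2 * γ' 1 0, γ' 1 1], by
    rw [Matrix.det_fin_two_of]; linear_combination det_eq_one γ' + γ' 1 0 * hb⟩, ⟨rfl, hb, rfl, rfl⟩⟩

lemma coe_mapGL (γ : SL(2, ℤ)) :
    ((Matrix.SpecialLinearGroup.mapGL ℝ γ : GL (Fin 2) ℝ) : Matrix (Fin 2) (Fin 2) ℝ) =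
      !![(γ 0 0 : ℝ), (γ 0 1 : ℝ); (γ 1 0 : ℝ), (γ 1 1 : ℝ)] := by
  ext i j
  fin_cases i <;> fin_cases j <;> simp

lemma coe_xi_mat (m : ℕ) (hm : 0 < m) :
    ((xi m hm).mat : Matrix (Fin 2) (Fin 2) ℝ) = !![1, 0; 0, (m : ℝ) ^ 2] := rfl

lemma coe_xiStar_mat (m : ℕ) (hm : 0 < m) :
    ((xiStar m hm).mat : Matrix (Fin 2) (Fin 2) ℝ) = !![(m : ℝ) ^ 2, 0; 0, 1] := rfl

lemma sq_cast_ne_zero {m : ℕ} (hm : 0 < m) : (m : ℝ) ^ 2 ≠ 0 := by positivity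

section

variable {m : ℕ} (hm : 0 < m) {γ γ' : SL(2, ℤ)}

lemma isDilate_iff_xiStar : IsDilate m γ γ' ↔
    (xiStar m hm).mat * Matrix.SpecialLinearGroup.mapGL ℝ γ =
      Matrix.SpecialLinearGroup.mapGL ℝ γ' * (xiStar m hm).mat := by
  have h0 := sq_cast_ne_zero hm
  rw [Units.ext_iff, Units.val_mul, Units.val_mul, coe_mapGL, coe_mapGL, coe_xiStar_mat,
    Matrix.mul_fin_two, Matrix.mul_fin_two]
  constructor
  · rintro ⟨h1, h2, h3, h4⟩
    simp only [h1, h2, h3, h4]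
    ext i j
    fin_cases i <;> fin_cases j <;> simp [mul_comm]
  · intro h
    have e00 := congrFun (congrFun h 0) 0
    have e01 := congrFun (congrFun h 0) 1
    have e10 := congrFun (congrFun h 1) 0
    have e11 := congrFun (congrFun h 1) 1
    simp only [Matrix.of_apply, Matrix.cons_val', Matrix.cons_val_zero, Matrix.cons_val_one,
      Matrix.cons_val_fin_one, zero_mul, mul_zero, add_zero, zero_add, one_mul, mul_one] at *
    refine ⟨?_, ?_, ?_, ?_⟩
    · have := mul_left_cancel₀ h0 (e00.trans (mul_comm _ _))
      exact_mod_cast this.symm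
    · exact_mod_cast e01.symm
    · rw [mul_comm] at e10
      exact_mod_cast e10
    · exact_mod_cast e11.symm

lemma isDilate_iff_xi : IsDilate m γ γ' ↔
    (xi m hm).mat * Matrix.SpecialLinearGroup.mapGL ℝ γ' =
      Matrix.SpecialLinearGroup.mapGL ℝ γ * (xi m hm).mat := by
  have h0 := sq_cast_ne_zero hm
  rw [Units.ext_iff, Units.val_mul, Units.val_mul, coe_mapGL, coe_mapGL, coe_xi_mat,
    Matrix.mul_fin_two, Matrix.mul_fin_two]
  constructor
  · rintro ⟨h1, h2, h3, h4⟩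
    simp only [h1, h2, h3, h4]
    ext i j
    fin_cases i <;> fin_cases j <;> simp [mul_comm]
  · intro h
    have e00 := congrFun (congrFun h 0) 0
    have e01 := congrFun (congrFun h 0) 1
    have e10 := congrFun (congrFun h 1) 0
    have e11 := congrFun (congrFun h 1) 1
    simp only [Matrix.of_apply, Matrix.cons_val', Matrix.cons_val_zero, Matrix.cons_val_one,
      Matrix.cons_val_fin_one, zero_mul, mul_zero, add_zero, zero_add, one_mul, mul_one] at *
    refine ⟨?_, ?_, ?_, ?_⟩
    · exact_mod_cast e00
    · rw [mul_comm]
      exact_mod_cast e01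
    · exact_mod_cast e10.symm
    · have := mul_left_cancel₀ h0 (e11.trans (mul_comm _ _))
      exact_mod_cast this

lemma coe_xiStar_smul (z : ℍ) : (((xiStar m hm).mat • z : ℍ) : ℂ) = (m : ℂ) ^ 2 * z := by
  rw [coe_smul_of_det_pos (xiStar m hm).det_pos]
  simp [num, denom, coe_xiStar_mat]

lemma coe_xi_smul (z : ℍ) : (m : ℂ) ^ 2 * (((xi m hm).mat • z : ℍ) : ℂ) = z := by
  have h0 : (m : ℂ) ≠ 0 := by exact_mod_cast hm.ne'
  rw [coe_smul_of_det_pos (xi m hm).det_pos]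
  simp only [num, denom, coe_xi_mat]
  simp
  field_simp

end

lemma quadSymbol_sq_mul {m c d : ℤ} (hm : m ≠ 0) (h : IsCoprime m d) :
    quadSymbol (m ^ 2 * c) d = quadSymbol c d := by
  have hg : m.gcd ((d.natAbs : ℕ) : ℤ) = 1 := by
    rw [Int.isCoprime_iff_gcd_eq_one] at h
    simpa only [Int.gcd, Int.natAbs_natCast] using h
  rw [quadSymbol, quadSymbol, jacobiSym.mul_left, jacobiSym.pow_left, jacobiSym.sq_one hg, one_mul]
  have : m ^ 2 * c < 0 ↔ c < 0 := by
    have : 0 < m ^ 2 := by positivity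
    constructor <;> intro h <;> nlinarith
  simp only [this]

/-- With `c = m² c'` and `w = m² z` one has `c' w + d = c z + d`, so the two square roots are
literally equal. The determinant forces `m` to be prime to `d`, hence `(c/d) = (c'/d)`; no condition
relating `m` to the level is needed. -/
lemma thetaFactor_of_isDilate {m : ℕ} (hm : 0 < m) {γ γ' : SL(2, ℤ)} (h : IsDilate m γ γ')
    {z w : ℍ} (hw : (w : ℂ) = (m : ℂ) ^ 2 * z) : thetaFactor γ' w = thetaFactor γ z := by
  have hco : IsCoprime (m : ℤ) (γ 1 1) :=
    ⟨-(γ 0 1 * (m * γ' 1 0)), γ 0 0, by linear_combination det_eq_one γ + γ 0 1 * h.h10⟩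
  rw [thetaFactor, thetaFactor, h.h11, h.h10, quadSymbol_sq_mul (by exact_mod_cast hm.ne') hco, hw]
  push_cast
  congr 2
  ring

section

variable {m N : ℕ} (hm : 0 < m) {γ γ' : Gamma0 (4 * N)}

lemma xiStar_mul_toDelta (h : IsDilate m γ γ') :
    xiStar m hm * toDelta γ = toDelta γ' * xiStar m hm := by
  refine Cover.ext ((isDilate_iff_xiStar hm).mp h) ?_
  funext z
  rw [Cover.mul_fac, Cover.mul_fac, mul_comm]
  change thetaFactor γ z * _ = thetaFactor γ' _ * _
  rw [thetaFactor_of_isDilate hm h (coe_xiStar_smul hm z)]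
  rfl

lemma xi_mul_toDelta (h : IsDilate m γ γ') :
    xi m hm * toDelta γ' = toDelta γ * xi m hm := by
  refine Cover.ext ((isDilate_iff_xi hm).mp h) ?_
  funext z
  rw [Cover.mul_fac, Cover.mul_fac, mul_comm]
  change thetaFactor γ' z * _ = thetaFactor γ _ * _
  rw [thetaFactor_of_isDilate hm h (coe_xi_smul hm z).symm]
  rfl

end

/-- The group `Γ⁰(M)` of matrices whose upper right entry is divisible by `M`. -/
def GammaUpper (M : ℕ) : Subgroup SL(2, ℤ) where
  carrier := {γ | (M : ℤ) ∣ γ 0 1}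
  one_mem' := by simp
  mul_mem' := by
    intro a b ha hb
    simp only [Set.mem_ofPred_eq] at ha hb ⊢
    rw [Matrix.SpecialLinearGroup.coe_mul, Matrix.mul_apply, Fin.sum_univ_two]
    exact dvd_add (hb.mul_left _) (ha.mul_right _)
  inv_mem' := by
    intro a ha
    simp only [Set.mem_ofPred_eq] at ha ⊢
    rw [Matrix.SpecialLinearGroup.SL2_inv_expl]
    simpa using ha

lemma mem_GammaUpper {M : ℕ} {γ : SL(2, ℤ)} : γ ∈ GammaUpper M ↔ (M : ℤ) ∣ γ 0 1 := Iff.rfl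

lemma mem_Gamma0_iff_dvd {M : ℕ} {γ : SL(2, ℤ)} : γ ∈ Gamma0 M ↔ (M : ℤ) ∣ γ 1 0 := by
  rw [Gamma0_mem, ZMod.intCast_zmod_eq_zero_iff_dvd]

/-! ### The stabilizers of the cosets of `ξ*` and `ξ` -/

section

variable {m N : ℕ} (hm : 0 < m)

/-- The group `Γ₀(4Nm²)` inside `Γ₀(4N)`. -/
abbrev lowerSubgroup (N m : ℕ) : Subgroup (Gamma0 (4 * N)) :=
  (Gamma0 (4 * (N * m ^ 2))).subgroupOf (Gamma0 (4 * N))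

/-- The group `Γ₀(4N) ∩ Γ⁰(m²)` inside `Γ₀(4N)`. -/
abbrev upperSubgroup (N m : ℕ) : Subgroup (Gamma0 (4 * N)) :=
  (GammaUpper (m ^ 2)).subgroupOf (Gamma0 (4 * N))

lemma exists_isDilate_of_mem_Gamma0 {γ : SL(2, ℤ)} (h : γ ∈ Gamma0 (4 * (N * m ^ 2))) :
    ∃ γ' ∈ Gamma0 (4 * N), IsDilate m γ γ' := by
  obtain ⟨t, ht⟩ := mem_Gamma0_iff_dvd.mp h
  obtain ⟨γ', h1, h2⟩ := exists_isDilate_right m γ (c := ((4 * N : ℕ) : ℤ) * t)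
    (by rw [ht]; push_cast; ring)
  exact ⟨γ', mem_Gamma0_iff_dvd.mpr ⟨t, h2⟩, h1⟩

lemma IsDilate.mem_Gamma0 {γ γ' : SL(2, ℤ)} (h : IsDilate m γ γ') (h' : γ' ∈ Gamma0 (4 * N)) :
    γ ∈ Gamma0 (4 * (N * m ^ 2)) := by
  obtain ⟨t, ht⟩ := mem_Gamma0_iff_dvd.mp h'
  exact mem_Gamma0_iff_dvd.mpr ⟨t, by rw [h.h10, ht]; push_cast; ring⟩

lemma IsDilate.mem_GammaUpper {γ γ' : SL(2, ℤ)} (h : IsDilate m γ γ') :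
    γ' ∈ GammaUpper (m ^ 2) :=
  HalfIntegral.mem_GammaUpper.mpr ⟨γ 0 1, by rw [h.h01]; push_cast; ring⟩

lemma Gamma0_mul_le (N n : ℕ) : Gamma0 (4 * (N * n)) ≤ Gamma0 (4 * N) := by
  intro γ h
  rw [mem_Gamma0_iff_dvd] at h ⊢
  refine dvd_trans ⟨n, ?_⟩ h
  push_cast
  ring

lemma exists_xiStar_mul_toDelta (χ : DirichletCharacter ℂ (4 * N)) (γ : Gamma0 (4 * N))
    (h : γ ∈ lowerSubgroup N m) : ∃ γ' : Gamma0 (4 * N),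
      xiStar m hm * toDelta γ = toDelta γ' * xiStar m hm ∧ charGamma χ γ' = charGamma χ γ := by
  obtain ⟨γ', h', hd⟩ := exists_isDilate_of_mem_Gamma0 (Subgroup.mem_subgroupOf.mp h)
  exact ⟨⟨γ', h'⟩, xiStar_mul_toDelta hm (γ' := ⟨γ', h'⟩) hd, by
    rw [charGamma, charGamma, hd.h11]⟩

lemma mem_lowerSubgroup_of_xiStar_mul (γ γ' : Gamma0 (4 * N))
    (h : xiStar m hm * toDelta γ = toDelta γ' * xiStar m hm) : γ ∈ lowerSubgroup N m :=
  Subgroup.mem_subgroupOf.mpr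
    (((isDilate_iff_xiStar hm).mpr (congrArg Cover.mat h)).mem_Gamma0 γ'.2)

lemma exists_xi_mul_toDelta (χ : DirichletCharacter ℂ (4 * N)) (γ : Gamma0 (4 * N))
    (h : γ ∈ upperSubgroup N m) : ∃ γ' : Gamma0 (4 * N),
      xi m hm * toDelta γ = toDelta γ' * xi m hm ∧ charGamma χ γ' = charGamma χ γ := by
  obtain ⟨γ', hd⟩ := exists_isDilate_left m γ (by
    have := mem_GammaUpper.mp (Subgroup.mem_subgroupOf.mp h)
    exact_mod_cast this)
  have h' : γ' ∈ Gamma0 (4 * N) := Gamma0_mul_le N (m ^ 2) (hd.mem_Gamma0 γ.2)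
  exact ⟨⟨γ', h'⟩, xi_mul_toDelta hm (γ := ⟨γ', h'⟩) hd, by rw [charGamma, charGamma, hd.h11]⟩

lemma mem_upperSubgroup_of_xi_mul (γ γ' : Gamma0 (4 * N))
    (h : xi m hm * toDelta γ = toDelta γ' * xi m hm) : γ ∈ upperSubgroup N m :=
  Subgroup.mem_subgroupOf.mpr ((isDilate_iff_xi hm).mpr (congrArg Cover.mat h)).mem_GammaUpper

end

/-! ### The trace of `f|V` and the operator `T*` -/

section

variable {κ N : ℕ} {χ : DirichletCharacter ℂ (4 * N)}

lemma cosetSum_smul (K : Subgroup (Gamma0 (4 * N))) (c : ℂ) (g : ℍ → ℂ) :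
    cosetSum κ χ K (c • g) = c • cosetSum κ χ K g := by
  rw [cosetSum, cosetSum, smul_finsum]
  refine finsum_congr fun q => ?_
  rw [slash_smul, smul_comm]

lemma cosetSum_zero (K : Subgroup (Gamma0 (4 * N))) : cosetSum κ χ K 0 = 0 := by
  simp [cosetSum, slash_zero]

lemma heckeOp_zero (ξ : Cover) : heckeOp κ χ ξ 0 = 0 := by
  simp [heckeOp, slash_zero]

lemma levelIndex_ne_zero (hN : 0 < N) {m : ℕ} (hm : 0 < m) : levelIndex N (N * m ^ 2) ≠ 0 := by
  have : NeZero (4 * (N * m ^ 2)) := ⟨by positivity⟩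
  exact Subgroup.FiniteIndex.index_ne_zero

lemma levelIndex_smul_trace (hN : 0 < N) {m : ℕ} (hm : 0 < m) (g : ℍ → ℂ) :
    (levelIndex N (N * m ^ 2) : ℂ) • trace κ N (N * m ^ 2) χ g =
      cosetSum κ χ (lowerSubgroup N m) g := by
  rw [trace_eq_cosetSum, smul_inv_smul₀]
  exact_mod_cast levelIndex_ne_zero hN hm

lemma slash_xiStar {m : ℕ} (hm : 0 < m) (f : ℍ → ℂ) :
    slash κ f (xiStar m hm) =
      (((m : ℝ) ^ weight κ : ℝ) : ℂ) • V (m ^ 2) (pow_pos hm 2) f := by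
  funext z
  have h2 : (m : ℝ) ^ weight κ = Real.sqrt m ^ (2 * κ + 1) := by
    rw [Real.sqrt_eq_rpow, ← Real.rpow_natCast, ← Real.rpow_mul (Nat.cast_nonneg m), weight]
    congr 1
    push_cast
    ring
  rw [slash, Pi.smul_apply, V, smul_eq_mul, mul_comm, h2]
  congr 1
  · change ((((Real.sqrt m : ℝ) : ℂ)⁻¹) ^ (2 * κ + 1))⁻¹ = _
    rw [inv_pow, inv_inv]
    push_cast
    rfl
  · congr 1
    ext1
    rw [coe_xiStar_smul]
    push_cast
    rfl

lemma det_xiStar_rpow {m : ℕ} (hm : 0 < m) :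
    (xiStar m hm).mat.det.val ^ (weight κ / 2 - 1) = (m : ℝ) ^ (weight κ - 2) := by
  have : (xiStar m hm).mat.det.val = (m : ℝ) ^ (2 : ℝ) := by
    rw [Matrix.GeneralLinearGroup.val_det_apply, coe_xiStar_mat, Matrix.det_fin_two_of]
    norm_num
  rw [this, ← Real.rpow_mul (Nat.cast_nonneg m)]
  congr 1
  ring

lemma det_xi_rpow {m : ℕ} (hm : 0 < m) :
    (xi m hm).mat.det.val ^ (weight κ / 2 - 1) = (m : ℝ) ^ (weight κ - 2) := by
  have : (xi m hm).mat.det.val = (m : ℝ) ^ (2 : ℝ) := by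
    rw [Matrix.GeneralLinearGroup.val_det_apply, coe_xi_mat, Matrix.det_fin_two_of]
    norm_num
  rw [this, ← Real.rpow_mul (Nat.cast_nonneg m)]
  congr 1
  ring

lemma V_zero {m : ℕ} (hm : 0 < m) : V m hm 0 = 0 := rfl

theorem levelIndex_smul_trace_V {f : ℍ → ℂ} (hf : IsCuspForm κ χ f) (hN : 0 < N) {d : ℕ}
    (hd : 0 < d) :
    (levelIndex N (N * d ^ 2) : ℂ) • trace κ N (N * d ^ 2) χ (V (d ^ 2) (pow_pos hd 2) f) =
      ((((d : ℝ) ^ (2 * (weight κ - 1)))⁻¹ : ℝ) : ℂ) • heckeTStar κ χ d hd f := by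
  rw [levelIndex_smul_trace hN hd, heckeTStar]
  -- Multiplicativity of `γ ↦ γ*` is available only from a nonzero form.
  rcases eq_or_ne f 0 with rfl | h0
  · rw [V_zero, cosetSum_zero, heckeOp_zero, smul_zero]
  · rw [heckeOp_eq_cosetSum hf (hf.toDelta_mul h0) _ (lowerSubgroup N d)
      (exists_xiStar_mul_toDelta hd χ) (mem_lowerSubgroup_of_xiStar_mul hd), det_xiStar_rpow,
      slash_xiStar, cosetSum_smul, smul_smul, smul_smul, ← Complex.ofReal_mul,
      ← Complex.ofReal_mul]
    have hd' : (0 : ℝ) < d := Nat.cast_pos.mpr hd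
    rw [← Real.rpow_neg hd'.le, ← Real.rpow_add hd', ← Real.rpow_add hd']
    -- The three exponents come from the claimed constant, the normalization `det^(k/2-1)`, and
    -- `f|ξ* = d^k f|V`.
    have : -(2 * (weight κ - 1)) + (weight κ - 2) + weight κ = 0 := by ring
    simp [this]

end

/-! ### The double cosets of `(1, p²)` and `(p², 1)` for `p ∤ 4N` -/

lemma sqrt_sq_mul {r : ℝ} (hr : 0 < r) (w : ℂ) :
    ((r : ℂ) ^ 2 * w) ^ (1 / 2 : ℂ) = r * w ^ (1 / 2 : ℂ) := by
  rcases eq_or_ne w 0 with rfl | hw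
  · simp
  have hr' : (r : ℂ) ≠ 0 := by exact_mod_cast hr.ne'
  have h2 : (0 : ℝ) < r ^ 2 := by positivity
  rw [← Complex.ofReal_pow, Complex.cpow_def_of_ne_zero (by simp [hr', hw]),
    Complex.cpow_def_of_ne_zero hw, Complex.log_ofReal_mul h2 hw, add_mul, Complex.exp_add,
    Real.log_pow]
  congr 1
  push_cast
  rw [show (2 : ℂ) * (Real.log r : ℂ) * (1 / 2) = (Real.log r : ℂ) by ring, ← Complex.ofReal_exp,
    Real.exp_log hr]

lemma quadSymbol_mul_sq {p c d : ℤ} (hd : d ≠ 0) (hp : p ≠ 0) (h : IsCoprime c p) :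
    quadSymbol c (p ^ 2 * d) = quadSymbol c d := by
  have hg : c.gcd ((p.natAbs : ℕ) : ℤ) = 1 := by
    rw [Int.isCoprime_iff_gcd_eq_one] at h
    simpa only [Int.gcd, Int.natAbs_natCast] using h
  have hd' : d.natAbs ≠ 0 := Int.natAbs_ne_zero.mpr hd
  have hp' : p.natAbs ^ 2 ≠ 0 := pow_ne_zero 2 (Int.natAbs_ne_zero.mpr hp)
  rw [quadSymbol, quadSymbol, Int.natAbs_mul, Int.natAbs_pow, jacobiSym.mul_right' _ hp' hd',
    jacobiSym.pow_right, jacobiSym.sq_one hg, one_mul]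
  have : p ^ 2 * d < 0 ↔ d < 0 := by
    have : 0 < p ^ 2 := by positivity
    constructor <;> intro h <;> nlinarith
  simp only [this]

lemma eps_mul_sq {p : ℤ} (hp : p % 2 = 1) (d : ℤ) : eps (p ^ 2 * d) = eps d := by
  have h : p ^ 2 % 4 = 1 := by
    rcases (by omega : p % 4 = 1 ∨ p % 4 = 3) with h | h <;> simp [pow_two, Int.mul_emod, h]
  rw [eps, eps, Int.mul_emod, h]
  simp

/-- Replacing `(c, e)` by `(c, p² e)` and `z` by `p² z` scales `c z + e` by `p²`, so the principal
root scales by `p`. The symbol and `eps` ignore the odd square `p²` prime to `c`; `e ≠ 0` is needed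
for multiplicativity of the Jacobi symbol below. -/
lemma thetaFactor_dilate_denom {p : ℕ} (hp : 0 < p) (hodd : (p : ℤ) % 2 = 1) {γ δ : SL(2, ℤ)}
    (h10 : δ 1 0 = γ 1 0) (h11 : δ 1 1 = (p : ℤ) ^ 2 * γ 1 1) (hne : γ 1 1 ≠ 0) {z w : ℍ}
    (hw : (w : ℂ) = (p : ℂ) ^ 2 * z) : thetaFactor δ w = p * thetaFactor γ z := by
  have hp0 : (p : ℤ) ≠ 0 := by exact_mod_cast hp.ne'
  have hco : IsCoprime (γ 1 0) (p : ℤ) :=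
    ⟨-δ 0 1, δ 0 0 * (p * γ 1 1), by
      linear_combination det_eq_one δ - δ 0 0 * h11 + δ 0 1 * h10⟩
  rw [thetaFactor, thetaFactor, h10, h11, eps_mul_sq hodd, quadSymbol_mul_sq hne hp0 hco, hw]
  have := sqrt_sq_mul (r := p) (by exact_mod_cast hp) (((γ 1 0 : ℤ) : ℂ) * z + ((γ 1 1 : ℤ) : ℂ))
  push_cast at this ⊢
  rw [show ((γ 1 0 : ℤ) : ℂ) * ((p : ℂ) ^ 2 * z) + (p : ℂ) ^ 2 * ((γ 1 1 : ℤ) : ℂ) =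
    (p : ℂ) ^ 2 * (((γ 1 0 : ℤ) : ℂ) * z + ((γ 1 1 : ℤ) : ℂ)) by ring, this]
  ring

lemma exists_swap_matrices {p N : ℕ} (hN : 0 < N) (hco : Nat.Coprime p (4 * N)) :
    ∃ δ γ : Gamma0 (4 * N), (δ : SL(2, ℤ)) 0 0 = 1 ∧ (γ : SL(2, ℤ)) 0 0 = (p : ℤ) ^ 2 ∧
      (δ : SL(2, ℤ)) 0 1 = (γ : SL(2, ℤ)) 0 1 ∧ (δ : SL(2, ℤ)) 1 0 = (γ : SL(2, ℤ)) 1 0 ∧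
      (δ : SL(2, ℤ)) 1 1 = (p : ℤ) ^ 2 * (γ : SL(2, ℤ)) 1 1 ∧ 0 < (γ : SL(2, ℤ)) 1 1 := by
  have h : IsCoprime ((p : ℤ) ^ 2) ((4 * N : ℕ) : ℤ) :=
    (Nat.isCoprime_iff_coprime.mpr hco).pow_left
  obtain ⟨u, v, huv⟩ := h
  set M : ℤ := ((4 * N : ℕ) : ℤ) with hM
  have hMpos : 0 < M := by rw [hM]; positivity
  -- Bézout gives `u p² + v M = 1`. Moving `u` by a multiple of `M` and compensating in `v` makes
  -- the lower right entry positive, in particular nonzero.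
  have hu : 0 < u + M * (|u| + 1) := by
    have := neg_abs_le u
    have := abs_nonneg u
    nlinarith
  have hmem : ∀ (a b e : ℤ) (h : Matrix.det !![a, b; M, e] = 1),
      (⟨!![a, b; M, e], h⟩ : SL(2, ℤ)) ∈ Gamma0 (4 * N) := fun a b e h =>
    mem_Gamma0_iff_dvd.mpr (dvd_refl M)
  refine ⟨⟨⟨!![1, -v + (p : ℤ) ^ 2 * (|u| + 1); M, (p : ℤ) ^ 2 * (u + M * (|u| + 1))], ?_⟩,
    hmem _ _ _ _⟩, ⟨⟨!![(p : ℤ) ^ 2, -v + (p : ℤ) ^ 2 * (|u| + 1); M, u + M * (|u| + 1)], ?_⟩,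
    hmem _ _ _ _⟩, rfl, rfl, rfl, rfl, rfl, hu⟩
  · rw [Matrix.det_fin_two_of]
    linear_combination huv
  · rw [Matrix.det_fin_two_of]
    linear_combination huv

/-- This identity in the covering group, not just for matrices, is what makes the double cosets of
`ξ` and `ξ*` coincide. -/
lemma toDelta_mul_xiStar_eq {p N : ℕ} (hp : 0 < p) (hodd : (p : ℤ) % 2 = 1)
    {δ γ : Gamma0 (4 * N)} (h00 : (δ : SL(2, ℤ)) 0 0 = 1) (h00' : (γ : SL(2, ℤ)) 0 0 = (p : ℤ) ^ 2)
    (h01 : (δ : SL(2, ℤ)) 0 1 = (γ : SL(2, ℤ)) 0 1)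
    (h10 : (δ : SL(2, ℤ)) 1 0 = (γ : SL(2, ℤ)) 1 0)
    (h11 : (δ : SL(2, ℤ)) 1 1 = (p : ℤ) ^ 2 * (γ : SL(2, ℤ)) 1 1)
    (hne : (γ : SL(2, ℤ)) 1 1 ≠ 0) :
    toDelta δ * xiStar p hp = xi p hp * toDelta γ := by
  refine Cover.ext ?_ ?_
  · change Matrix.SpecialLinearGroup.mapGL ℝ (δ : SL(2, ℤ)) * _ =
      _ * Matrix.SpecialLinearGroup.mapGL ℝ (γ : SL(2, ℤ))
    rw [Units.ext_iff, Units.val_mul, Units.val_mul, coe_mapGL, coe_mapGL, coe_xiStar_mat,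
      coe_xi_mat, Matrix.mul_fin_two, Matrix.mul_fin_two, h00, h00', h01, h10, h11]
    ext i j
    fin_cases i <;> fin_cases j <;> simp [mul_comm]
  · funext z
    rw [Cover.mul_fac, Cover.mul_fac]
    change thetaFactor δ _ * ((Real.sqrt p : ℝ) : ℂ)⁻¹ = ((Real.sqrt p : ℝ) : ℂ) * thetaFactor γ z
    rw [thetaFactor_dilate_denom hp hodd h10 h11 hne (coe_xiStar_smul hp z)]
    have h : ((Real.sqrt p : ℝ) : ℂ) * ((Real.sqrt p : ℝ) : ℂ) = p := by
      rw [← Complex.ofReal_mul, Real.mul_self_sqrt (Nat.cast_nonneg p), Complex.ofReal_natCast]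
    have h0 : ((Real.sqrt p : ℝ) : ℂ) ≠ 0 :=
      Complex.ofReal_ne_zero.mpr (Real.sqrt_pos.mpr (Nat.cast_pos.mpr hp)).ne'
    rw [← h]
    field_simp

section

variable {κ N : ℕ} {χ : DirichletCharacter ℂ (4 * N)}

/-- Here `K' = τ⁻¹ K τ`, so `γ ↦ τ γ` carries cosets of `K'` to cosets of `K`; reindexing the sum
costs one factor `χ(τ)`. -/
lemma cosetSum_conj (hΔ : ∀ α β : Gamma0 (4 * N), toDelta (α * β) = toDelta α * toDelta β)
    {K K' : Subgroup (Gamma0 (4 * N))} (τ : Gamma0 (4 * N))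
    (hK : ∀ γ, γ ∈ K' ↔ τ * γ * τ⁻¹ ∈ K) {g : ℍ → ℂ}
    (hg : ∀ k ∈ K, slash κ g (toDelta k) = charGamma χ k • g) :
    cosetSum κ χ K' (slash κ g (toDelta τ)) = charGamma χ τ • cosetSum κ χ K g := by
  let e : Quotient (QuotientGroup.rightRel K') → Quotient (QuotientGroup.rightRel K) :=
    fun q => Quotient.mk _ (τ * Quotient.out q)
  have hout : ∀ q, Quotient.out (e q) * (τ * Quotient.out q)⁻¹ ∈ K := fun q =>
    QuotientGroup.rightRel_apply.mp (Quotient.exact (Quotient.out_eq (e q)).symm)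
  have he : Function.Bijective e := by
    constructor
    · intro q q' h
      rw [← Quotient.out_eq q, ← Quotient.out_eq q']
      refine Quotient.sound (QuotientGroup.rightRel_apply.mpr ((hK _).mpr ?_))
      have := QuotientGroup.rightRel_apply.mp (Quotient.exact h)
      rwa [mul_inv_rev, ← mul_assoc, mul_assoc τ] at this
    · intro Q
      obtain ⟨γ, rfl⟩ := Quotient.exists_rep Q
      refine ⟨Quotient.mk _ (τ⁻¹ * γ), Quotient.sound (QuotientGroup.rightRel_apply.mpr ?_)⟩
      have h := QuotientGroup.rightRel_apply.mp (Quotient.exact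
        (Quotient.out_eq (Quotient.mk (QuotientGroup.rightRel K') (τ⁻¹ * γ))))
      rw [hK] at h
      convert h using 1
      group
  rw [cosetSum, cosetSum, smul_finsum]
  refine finsum_eq_of_bijective e he fun q => ?_
  have h := coset_term_mul hΔ (hg _ (hout q)) (τ * Quotient.out q)
  rw [inv_mul_cancel_right] at h
  rw [h, hΔ, slash_mul, charGamma_mul, map_mul, smul_smul, ← mul_assoc, mul_comm (charGamma χ τ),
    conj_mul_charGamma, one_mul]

theorem exists_cosetSum_lower_eq_upper {f : ℍ → ℂ} (hf : IsCuspForm κ χ f) (h0 : f ≠ 0)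
    (hN : 0 < N) {p : ℕ} (hp : p.Prime) (hpN : ¬ p ∣ 4 * N) :
    ∃ c : ℂ, cosetSum κ χ (lowerSubgroup N p) (slash κ f (xiStar p hp.pos)) =
        c • cosetSum κ χ (upperSubgroup N p) (slash κ f (xi p hp.pos)) ∧
      χ (p : ZMod (4 * N)) ^ 2 * c = 1 := by
  have hΔ := hf.toDelta_mul h0
  have hco : Nat.Coprime p (4 * N) := (Nat.Prime.coprime_iff_not_dvd hp).mpr hpN
  have hodd : (p : ℤ) % 2 = 1 := by
    rcases hp.eq_two_or_odd with h | h
    · exact absurd (h ▸ ⟨2 * N, by ring⟩) hpN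
    · omega
  obtain ⟨δ, τ, h00, h00', h01, h10, h11, hpos⟩ := exists_swap_matrices hN hco
  have hswap := toDelta_mul_xiStar_eq hp.pos hodd h00 h00' h01 h10 h11 hpos.ne'
  have hδτ : charGamma χ δ = χ (p : ZMod (4 * N)) ^ 2 * charGamma χ τ := by
    rw [charGamma, charGamma, h11, ← map_pow, ← map_mul]
    push_cast
    rfl
  -- The upper left entry of `δ` is 1, so the determinant makes its lower right entry 1 modulo `4N`.
  have hδ : charGamma χ δ = 1 := by
    have h := congrArg (Int.cast : ℤ → ZMod (4 * N)) (det_eq_one δ)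
    have h0 := Gamma0_mem.mp δ.2
    push_cast at h
    rw [h0, mul_zero, sub_zero, h00, Int.cast_one, one_mul] at h
    rw [charGamma, h, map_one]
  refine ⟨charGamma χ τ, ?_, by rw [← hδτ, hδ]⟩
  have hslash : slash κ f (xiStar p hp.pos) = slash κ (slash κ f (xi p hp.pos)) (toDelta τ) := by
    rw [← slash_mul, ← hswap, slash_mul, hf.slash_eq, hδ, one_smul]
  have hx : xi p hp.pos = toDelta δ * xiStar p hp.pos * (toDelta τ)⁻¹ := by
    rw [hswap, mul_inv_cancel_right]
  rw [hslash]
  refine cosetSum_conj hΔ τ (fun γ => ⟨fun h => ?_, fun h => ?_⟩) fun k hk => ?_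
  · obtain ⟨γ', h', -⟩ := exists_xiStar_mul_toDelta hp.pos χ γ h
    refine mem_upperSubgroup_of_xi_mul hp.pos _ (δ * γ' * δ⁻¹) ?_
    rw [hΔ, hΔ, hΔ, hΔ, toDelta_inv_of_mul hΔ, toDelta_inv_of_mul hΔ, ← mul_assoc, ← mul_assoc,
      ← hswap, mul_assoc (toDelta δ), h', hx]
    group
  · obtain ⟨γ', h', -⟩ := exists_xi_mul_toDelta hp.pos χ _ h
    refine mem_lowerSubgroup_of_xiStar_mul hp.pos _ (δ⁻¹ * γ' * δ) ?_
    have hxs : xiStar p hp.pos = (toDelta δ)⁻¹ * xi p hp.pos * toDelta τ := by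
      rw [mul_assoc, ← hswap, inv_mul_cancel_left]
    rw [hΔ, hΔ, toDelta_inv_of_mul hΔ] at h' ⊢
    rw [mul_assoc _ (toDelta δ), hswap, mul_assoc, ← mul_assoc (toDelta γ'), ← h', hxs]
    group
  · obtain ⟨γ', h', h''⟩ := exists_xi_mul_toDelta hp.pos χ k hk
    rw [slash_slash_of_commute hf h', h'']

end

/-! ### The index of `Γ₀(4Np²)` in `Γ₀(4N)` -/

section

variable {G : Type*} [Group G] {K : Subgroup G} {ι : Type*}

lemma bijective_mk_of_existsUnique {s : ι → G} (hs : ∀ g, ∃! i, g * (s i)⁻¹ ∈ K) :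
    Function.Bijective (fun i => (Quotient.mk (QuotientGroup.rightRel K) (s i))) := by
  constructor
  · intro i j h
    have h' := QuotientGroup.rightRel_apply.mp (Quotient.exact h)
    exact (hs (s j)).unique h' (by rw [mul_inv_cancel]; exact K.one_mem)
  · intro q
    obtain ⟨g, rfl⟩ := Quotient.exists_rep q
    obtain ⟨i, hi, -⟩ := hs g
    exact ⟨i, Quotient.sound (QuotientGroup.rightRel_apply.mpr hi)⟩

lemma index_eq_card_of_existsUnique {s : ι → G} (hs : ∀ g, ∃! i, g * (s i)⁻¹ ∈ K) :
    K.index = Nat.card ι := by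
  rw [Subgroup.index, ← Nat.card_congr (QuotientGroup.quotientRightRelEquivQuotientLeftRel K)]
  exact (Nat.card_congr (Equiv.ofBijective _ (bijective_mk_of_existsUnique hs))).symm

lemma existsUnique_mul_inv_out_mem (g : G) :
    ∃! q : Quotient (QuotientGroup.rightRel K), g * (Quotient.out q)⁻¹ ∈ K := by
  refine ⟨Quotient.mk _ g, QuotientGroup.rightRel_apply.mp (Quotient.exact (Quotient.out_eq _)),
    fun q hq => ?_⟩
  rw [← Quotient.out_eq q]
  exact Quotient.sound (QuotientGroup.rightRel_apply.mpr hq)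

end

lemma existsUnique_dvd_mul_sub {n : ℕ} (hn : 0 < n) {a : ℤ} (ha : IsCoprime (n : ℤ) a) (b : ℤ) :
    ∃! j : Fin n, (n : ℤ) ∣ a * (j : ℤ) - b := by
  obtain ⟨u, v, huv⟩ := ha
  have hn' : (0 : ℤ) < n := by exact_mod_cast hn
  have h0 := Int.emod_nonneg (v * b) hn'.ne'
  have h1 := Int.emod_lt_of_pos (v * b) hn'
  refine ⟨⟨((v * b) % n).toNat, by omega⟩, ?_, ?_⟩
  · have h2 := Int.emod_add_mul_ediv (v * b) n
    simp only [Int.toNat_of_nonneg h0]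
    exact ⟨-(u * b) - a * (v * b / n), by linear_combination a * h2 + b * huv⟩
  · rintro j hj
    have h2 : (n : ℤ) ∣ (j : ℤ) - v * b := by
      have h3 : (n : ℤ) ∣ v * (a * j - b) := hj.mul_left v
      have h4 : (j : ℤ) - v * b = v * (a * j - b) + n * (u * j) := by
        linear_combination -(j : ℤ) * huv
      rw [h4]
      exact dvd_add h3 (dvd_mul_right _ _)
    have h3 : (v * b) % n = (j : ℤ) := by
      have h5 : (v * b) % n = (j : ℤ) % n := Int.modEq_iff_dvd.mpr h2
      rw [h5, Int.emod_eq_of_lt (Int.natCast_nonneg _) (by exact_mod_cast j.2)]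
    ext
    simp only
    omega

lemma mul_inv_lower_left (γ δ : SL(2, ℤ)) :
    (γ * δ⁻¹) 1 0 = γ 1 0 * δ 1 1 - γ 1 1 * δ 1 0 := by
  rw [Matrix.SpecialLinearGroup.coe_mul, Matrix.SpecialLinearGroup.coe_inv,
    Matrix.adjugate_fin_two, Matrix.mul_apply, Fin.sum_univ_two]
  simp
  ring

/-- Divisibility by `4N` is automatic, so a coset is determined by its lower row as a point of the
projective line over `ℤ/p²`. -/
lemma mul_inv_mem_lowerSubgroup_iff {p N : ℕ} (hco : Nat.Coprime p (4 * N))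
    (γ δ : Gamma0 (4 * N)) :
    γ * δ⁻¹ ∈ lowerSubgroup N p ↔ ((p ^ 2 : ℕ) : ℤ) ∣
      (γ : SL(2, ℤ)) 1 0 * (δ : SL(2, ℤ)) 1 1 - (γ : SL(2, ℤ)) 1 1 * (δ : SL(2, ℤ)) 1 0 := by
  rw [Subgroup.mem_subgroupOf, mem_Gamma0_iff_dvd]
  change _ ∣ ((γ : SL(2, ℤ)) * (δ : SL(2, ℤ))⁻¹) 1 0 ↔ _
  have h : ((4 * N : ℕ) : ℤ) ∣ ((γ : SL(2, ℤ)) * (δ : SL(2, ℤ))⁻¹) 1 0 :=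
    mem_Gamma0_iff_dvd.mp (γ * δ⁻¹).2
  rw [mul_inv_lower_left] at h ⊢
  have hco' : IsCoprime ((4 * N : ℕ) : ℤ) ((p ^ 2 : ℕ) : ℤ) :=
    Nat.isCoprime_iff_coprime.mpr (Nat.Coprime.pow_right 2 hco.symm)
  rw [← mul_assoc, Nat.cast_mul (4 * N) (p ^ 2)]
  exact ⟨fun h' => (dvd_mul_left _ _).trans h', fun h' => hco'.mul_dvd h h'⟩

/-- The projective line over `ℤ/p²` has `p²` points `(c : e)` with `e` a unit and `p` points with `p
∣ e`. The family `s₁` has lower rows `(4Nj, 1)` and meets the former. The family `s₂` consists of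
the products `δ (1 pl; 0 1)`, where `δ` has lower right entry divisible by `p²`, and meets the
latter. -/
theorem levelIndex_prime_sq {N : ℕ} (hN : 0 < N) {p : ℕ} (hp : p.Prime) (hpN : ¬ p ∣ 4 * N) :
    levelIndex N (N * p ^ 2) = p ^ 2 + p := by
  have hco : Nat.Coprime p (4 * N) := (Nat.Prime.coprime_iff_not_dvd hp).mpr hpN
  have hpN' : ¬ (p : ℤ) ∣ ((4 * N : ℕ) : ℤ) := by exact_mod_cast hpN
  have hpp : Prime (p : ℤ) := Nat.prime_iff_prime_int.mp hp
  obtain ⟨δ, τ, -, -, -, -, h11, -⟩ := exists_swap_matrices hN hco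
  have hδ10 : ¬ (p : ℤ) ∣ (δ : SL(2, ℤ)) 1 0 := by
    intro h
    refine hpp.not_isUnit (isUnit_of_dvd_one ?_)
    rw [← det_eq_one (δ : SL(2, ℤ)), h11]
    exact dvd_sub (((dvd_pow_self _ two_ne_zero).mul_right _).mul_left _) (h.mul_left _)
  let s₁ : Fin (p ^ 2) → Gamma0 (4 * N) := fun j =>
    ⟨⟨!![1, 0; ((4 * N : ℕ) : ℤ) * j, 1], by rw [Matrix.det_fin_two_of]; ring⟩,
      mem_Gamma0_iff_dvd.mpr (show _ ∣ ((4 * N : ℕ) : ℤ) * (j : ℤ) from dvd_mul_right _ _)⟩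
  let s₂ : Fin p → Gamma0 (4 * N) := fun l =>
    ⟨⟨!![(δ : SL(2, ℤ)) 0 0, (δ : SL(2, ℤ)) 0 1 + (δ : SL(2, ℤ)) 0 0 * (p * l);
      (δ : SL(2, ℤ)) 1 0, (δ : SL(2, ℤ)) 1 1 + (δ : SL(2, ℤ)) 1 0 * (p * l)], by
        rw [Matrix.det_fin_two_of]; linear_combination det_eq_one (δ : SL(2, ℤ))⟩,
      mem_Gamma0_iff_dvd.mpr (mem_Gamma0_iff_dvd.mp δ.2)⟩
  have hs₁ : ∀ γ j, γ * (s₁ j)⁻¹ ∈ lowerSubgroup N p ↔ ((p ^ 2 : ℕ) : ℤ) ∣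
      (γ : SL(2, ℤ)) 1 1 * ((4 * N : ℕ) : ℤ) * (j : ℕ) - (γ : SL(2, ℤ)) 1 0 := by
    intro γ j
    rw [mul_inv_mem_lowerSubgroup_iff hco, ← dvd_neg]
    change _ ∣ -((γ : SL(2, ℤ)) 1 0 * 1 - (γ : SL(2, ℤ)) 1 1 * (((4 * N : ℕ) : ℤ) * j)) ↔ _
    ring_nf
  have hs₂ : ∀ γ l, γ * (s₂ l)⁻¹ ∈ lowerSubgroup N p ↔ ((p ^ 2 : ℕ) : ℤ) ∣
      (δ : SL(2, ℤ)) 1 0 * ((γ : SL(2, ℤ)) 1 0 * (p * (l : ℕ)) - (γ : SL(2, ℤ)) 1 1) := by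
    intro γ l
    rw [mul_inv_mem_lowerSubgroup_iff hco]
    change _ ∣ (γ : SL(2, ℤ)) 1 0 * ((δ : SL(2, ℤ)) 1 1 + (δ : SL(2, ℤ)) 1 0 * (p * l)) -
      (γ : SL(2, ℤ)) 1 1 * (δ : SL(2, ℤ)) 1 0 ↔ _
    have h : ((p ^ 2 : ℕ) : ℤ) ∣ (γ : SL(2, ℤ)) 1 0 * (δ : SL(2, ℤ)) 1 1 := by
      rw [h11]
      push_cast
      exact (dvd_mul_right _ _).mul_left _
    refine Iff.trans ?_ (dvd_add_right h)
    ring_nf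
  have hcard : Nat.card (Fin (p ^ 2) ⊕ Fin p) = p ^ 2 + p := by simp
  rw [← hcard]
  refine index_eq_card_of_existsUnique (K := lowerSubgroup N p) (s := Sum.elim s₁ s₂) fun γ => ?_
  have hγ := det_eq_one (γ : SL(2, ℤ))
  by_cases he : (p : ℤ) ∣ (γ : SL(2, ℤ)) 1 1
  · obtain ⟨e, he⟩ := he
    have hc : ¬ (p : ℤ) ∣ (γ : SL(2, ℤ)) 1 0 := by
      intro h
      refine hpp.not_isUnit (isUnit_of_dvd_one ?_)
      rw [← hγ, he]
      exact dvd_sub ((dvd_mul_right _ _).mul_left _) (h.mul_left _)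
    obtain ⟨l, hl, hl'⟩ := existsUnique_dvd_mul_sub hp.pos
      ((Prime.coprime_iff_not_dvd hpp).mpr hc) e
    have hiff : ∀ l, γ * (s₂ l)⁻¹ ∈ lowerSubgroup N p ↔
        (p : ℤ) ∣ (γ : SL(2, ℤ)) 1 0 * (l : ℕ) - e := by
      intro l
      rw [hs₂, he, show (δ : SL(2, ℤ)) 1 0 * ((γ : SL(2, ℤ)) 1 0 * (p * (l : ℕ)) - p * e) =
        p * ((δ : SL(2, ℤ)) 1 0 * ((γ : SL(2, ℤ)) 1 0 * (l : ℕ) - e)) by ring, Nat.cast_pow,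
        pow_two, mul_dvd_mul_iff_left hpp.ne_zero, hpp.dvd_mul]
      simp [hδ10]
    refine ⟨Sum.inr l, (hiff l).mpr hl, ?_⟩
    rintro (j | l₂) h
    · exfalso
      have h := (hs₁ γ j).mp h
      rw [he, Nat.cast_pow] at h
      have h2 := (dvd_pow_self (p : ℤ) two_ne_zero).trans h
      rw [mul_assoc, mul_assoc] at h2
      exact hc ((dvd_sub_right (dvd_mul_right _ _)).mp h2)
    · rw [hl' l₂ ((hiff l₂).mp h)]
  · have hco2 : IsCoprime ((p ^ 2 : ℕ) : ℤ) ((γ : SL(2, ℤ)) 1 1 * ((4 * N : ℕ) : ℤ)) := by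
      rw [Nat.cast_pow]
      refine IsCoprime.pow_left ((Prime.coprime_iff_not_dvd hpp).mpr fun h => ?_)
      rcases hpp.dvd_mul.mp h with h | h
      · exact he h
      · exact hpN' h
    obtain ⟨j, hj, hj'⟩ := existsUnique_dvd_mul_sub (pow_pos hp.pos 2) hco2 ((γ : SL(2, ℤ)) 1 0)
    refine ⟨Sum.inl j, (hs₁ γ j).mpr hj, ?_⟩
    rintro (j₂ | l) h
    · rw [hj' j₂ ((hs₁ γ j₂).mp h)]
    · exfalso
      have h := (hs₂ γ l).mp h
      rw [Nat.cast_pow] at h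
      rcases hpp.dvd_mul.mp ((dvd_pow_self (p : ℤ) two_ne_zero).trans h) with h | h
      · exact hδ10 h
      · exact he ((dvd_sub_right ((dvd_mul_right _ _).mul_left _)).mp h)

/-! ### The Petersson integrand -/

/-- The integrand `g₁(z) conj(g₂(z)) y^k` of the Petersson product. -/
def integrand (κ : ℕ) (g₁ g₂ : ℍ → ℂ) (z : ℍ) : ℂ :=
  g₁ z * conj (g₂ z) * ((z.im ^ weight κ : ℝ) : ℂ)

/-- Since `|φ|⁴ = |c z + e|² / det`, the determinant disappears from the formula. -/
lemma Cover.im_smul (x : Cover) (z : ℍ) : (x.mat • z : ℍ).im = z.im / (‖x.fac z‖ ^ 2) ^ 2 := by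
  obtain ⟨t, ht, h⟩ := x.sq
  have hd := x.det_pos
  have h1 : ‖x.fac z‖ ^ 2 = (Real.sqrt x.mat.det.val)⁻¹ * ‖denom x.mat z‖ := by
    rw [← norm_pow, h, norm_mul, norm_mul, ht, one_mul, norm_inv, Complex.norm_real,
      Real.norm_of_nonneg (Real.sqrt_nonneg _)]
  rw [im_smul_eq_div_normSq, h1, mul_pow, inv_pow, Real.sq_sqrt hd.le, abs_of_pos hd,
    Complex.normSq_eq_norm_sq]
  field_simp

/-- Both the two slash factors and `Im(αz)^k` contribute `|φ|^(-4k)`. The integrand is thus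
equivariant under the whole covering group, including `ξ` and `ξ*`. -/
lemma integrand_slash (κ : ℕ) (g₁ g₂ : ℍ → ℂ) (x : Cover) (z : ℍ) :
    integrand κ (slash κ g₁ x) (slash κ g₂ x) z = integrand κ g₁ g₂ (x.mat • z) := by
  have h0 : 0 < ‖x.fac z‖ := norm_pos_iff.mpr (x.fac_ne_zero z)
  have h1 : ((‖x.fac z‖ ^ 2) ^ 2) ^ weight κ = (‖x.fac z‖ ^ (2 * κ + 1)) ^ 2 := by
    rw [← pow_mul, ← pow_mul, ← Real.rpow_natCast, ← Real.rpow_natCast, ← Real.rpow_mul h0.le,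
      weight]
    congr 1
    push_cast
    ring
  have h2 : x.fac z ^ (2 * κ + 1) * conj (x.fac z ^ (2 * κ + 1)) =
      (((‖x.fac z‖ ^ (2 * κ + 1)) ^ 2 : ℝ) : ℂ) := by
    rw [Complex.mul_conj, Complex.normSq_eq_norm_sq, norm_pow]
  have h3 := pow_ne_zero (2 * κ + 1) (x.fac_ne_zero z)
  rw [integrand, integrand, slash, slash, x.im_smul, Real.div_rpow z.im_pos.le (by positivity), h1,
    Complex.ofReal_div, ← h2, map_mul, map_inv₀]
  have h4 : conj (x.fac z ^ (2 * κ + 1)) ≠ 0 := (map_ne_zero _).mpr h3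
  field_simp

lemma integrand_smul_left (κ : ℕ) (c : ℂ) (g₁ g₂ : ℍ → ℂ) (z : ℍ) :
    integrand κ (c • g₁) g₂ z = c * integrand κ g₁ g₂ z := by
  simp only [integrand, Pi.smul_apply, smul_eq_mul]
  ring

lemma integrand_smul_right (κ : ℕ) (c : ℂ) (g₁ g₂ : ℍ → ℂ) (z : ℍ) :
    integrand κ g₁ (c • g₂) z = conj c * integrand κ g₁ g₂ z := by
  simp only [integrand, Pi.smul_apply, smul_eq_mul, map_mul]
  ring

lemma integrand_self (κ : ℕ) (g : ℍ → ℂ) (z : ℍ) :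
    integrand κ g g z = ((‖g z‖ ^ 2 * z.im ^ weight κ : ℝ) : ℂ) := by
  rw [integrand, Complex.mul_conj, Complex.normSq_eq_norm_sq, Complex.ofReal_mul]

lemma norm_integrand_sq (κ : ℕ) (g₁ g₂ : ℍ → ℂ) (z : ℍ) :
    ‖integrand κ g₁ g₂ z‖ ^ 2 = ‖integrand κ g₁ g₁ z‖ * ‖integrand κ g₂ g₂ z‖ := by
  simp only [integrand, norm_mul, Complex.norm_conj]
  ring

lemma continuous_integrand {κ : ℕ} {g₁ g₂ : ℍ → ℂ} (h₁ : Continuous g₁) (h₂ : Continuous g₂) :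
    Continuous (integrand κ g₁ g₂) := by
  refine (h₁.mul (Complex.continuous_conj.comp h₂)).mul (Complex.continuous_ofReal.comp ?_)
  exact continuous_im.rpow_const fun z => Or.inl z.im_ne_zero

lemma continuous_slash {κ : ℕ} {g : ℍ → ℂ} (hg : Continuous g) (x : Cover) :
    Continuous (slash κ g x) := by
  refine (hg.comp ?_).mul ((x.continuous_fac.pow _).inv₀ fun z => pow_ne_zero _ (x.fac_ne_zero z))
  exact continuous_const_smul _

/-! ### Cusp forms are bounded -/

/-- The lift of `σ ∈ SL₂(ℤ)` to the covering group by the principal square root. -/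
def principalLift (σ : SL(2, ℤ)) : Cover where
  mat := Matrix.SpecialLinearGroup.mapGL ℝ σ
  fac := fun z => ((σ 1 0 : ℂ) * z + (σ 1 1 : ℂ)) ^ (1 / 2 : ℂ)
  det_pos := by simp
  holo := holo_sqrt _ _ (by
    by_contra hcon
    push Not at hcon
    have := det_eq_one σ
    rw [hcon.1, hcon.2] at this
    simp at this)
  sq := ⟨1, norm_one, fun z => by
    rw [← Complex.cpow_nat_mul]
    simp [denom]⟩

open scoped ModularForm in
-- A `4n`-th power turns weight `k` into the even integer `4nk`, where `φ²` alone determines the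
-- slash factor.
lemma slash_pow_eq (κ n : ℕ) (f : ℍ → ℂ) {x : Cover} {σ : SL(2, ℤ)} {t : ℂ}
    (ht : ∀ z, x.fac z ^ 2 = t * denom x.mat z)
    (hx : x.mat = Matrix.SpecialLinearGroup.mapGL ℝ σ) (z : ℍ) :
    ((f ^ (4 * n)) ∣[((2 * n * (2 * κ + 1) : ℕ) : ℤ)] σ) z =
      t ^ (2 * n * (2 * κ + 1)) * (slash κ f x z) ^ (4 * n) := by
  have hfac : x.fac z ^ ((2 * κ + 1) * (4 * n)) =
      t ^ (2 * n * (2 * κ + 1)) * denom x.mat z ^ (2 * n * (2 * κ + 1)) := by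
    rw [← mul_pow, ← ht, ← pow_mul]
    congr 1
    ring
  have hd := denom_ne_zero x.mat z
  have h0 := x.fac_ne_zero z
  have ht0 : t ^ (2 * n * (2 * κ + 1)) ≠ 0 := by
    intro h
    rw [h, zero_mul] at hfac
    exact pow_ne_zero _ h0 hfac
  rw [ModularForm.SL_slash_apply, slash, mul_pow, inv_pow, ← pow_mul, hfac, hx, Pi.pow_apply,
    zpow_neg, zpow_natCast]
  rw [hx] at hd
  change f (Matrix.SpecialLinearGroup.mapGL ℝ σ • z) ^ (4 * n) *
    (denom (Matrix.SpecialLinearGroup.mapGL ℝ σ) z ^ (2 * n * (2 * κ + 1)))⁻¹ = _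
  field_simp

section

variable {κ N : ℕ} {χ : DirichletCharacter ℂ (4 * N)} {f : ℍ → ℂ}

lemma charGamma_pow_totient (γ : Gamma0 (4 * N)) :
    charGamma χ γ ^ (4 * N).totient = 1 := by
  obtain ⟨u, hu⟩ := isUnit_lower_right γ
  rw [charGamma, ← hu, ← map_pow, ← Units.val_pow_eq_pow_val, ZMod.pow_totient, Units.val_one,
    map_one]

/-- The `4φ(4N)`-th power of a cusp form, as a cusp form of integral weight. -/
def IsCuspForm.powForm (hf : IsCuspForm κ χ f) (hN : 0 < N) :
    CuspForm ((Gamma0 (4 * N)).map (Matrix.SpecialLinearGroup.mapGL ℝ))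
      ((2 * (4 * N).totient * (2 * κ + 1) : ℕ) : ℤ) where
  toFun := f ^ (4 * (4 * N).totient)
  slash_action_eq' := by
    rintro _ ⟨γ, hγ, rfl⟩
    funext z
    have h := slash_pow_eq κ (4 * N).totient f (x := toDelta (⟨γ, hγ⟩ : Gamma0 (4 * N)))
      (t := (eps (γ 1 1))⁻¹ ^ 2) (fun z => thetaFactor_sq γ z) rfl z
    -- The factor 4 in the exponent `4φ(4N)` removes the fourth roots of unity `eps`, and `φ(4N)`
    -- removes the character.
    have ht : ((eps (γ 1 1))⁻¹ ^ 2) ^ (2 * (4 * N).totient * (2 * κ + 1)) = 1 := by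
      rw [mul_assoc, pow_mul, ← pow_mul, eps]
      split_ifs <;> simp
    have hχ : charGamma χ (⟨γ, hγ⟩ : Gamma0 (4 * N)) ^ (4 * (4 * N).totient) = 1 := by
      rw [pow_mul', charGamma_pow_totient, one_pow]
    rw [hf.slash_eq, ht, one_mul, Pi.smul_apply, smul_eq_mul, mul_pow, hχ, one_mul] at h
    exact h
  holo' := hf.holo.pow _
  zero_at_cusps' := by
    intro c hc
    have : NeZero (4 * N) := ⟨by positivity⟩
    rw [Subgroup.IsArithmetic.isCusp_iff_isCusp_SL2Z] at hc
    rw [OnePoint.isZeroAt_iff_forall_SL2Z hc]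
    intro σ _
    have hz := hf.zero_at_cusps σ (principalLift σ) rfl
    have hpos : 4 * (4 * N).totient ≠ 0 := by
      have := Nat.totient_pos.mpr (show 0 < 4 * N by positivity)
      positivity
    have h := slash_pow_eq κ (4 * N).totient f (x := principalLift σ) (t := 1) (fun z => by
      change (((σ 1 0 : ℂ) * z + (σ 1 1 : ℂ)) ^ (1 / 2 : ℂ)) ^ 2 =
        1 * denom (Matrix.SpecialLinearGroup.mapGL ℝ σ) z
      rw [← Complex.cpow_nat_mul]
      simp [denom]) rfl
    rw [IsZeroAtImInfty, Filter.ZeroAtFilter] at hz ⊢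
    have h2 := hz.pow (4 * (4 * N).totient)
    rw [zero_pow hpos] at h2
    refine h2.congr fun z => ?_
    have h3 := h z
    rw [one_pow, one_mul] at h3
    exact h3.symm

/-- The bound for the integral weight form `f^(4n)` is a bound for `(|f|² y^k)^(2n)`. No root has to
be extracted: a number above 1 is at most its own power. -/
theorem IsCuspForm.exists_norm_integrand_le (hf : IsCuspForm κ χ f) (hN : 0 < N) :
    ∃ C, ∀ z, ‖integrand κ f f z‖ ≤ C := by
  have : NeZero (4 * N) := ⟨by positivity⟩
  obtain ⟨C, hC⟩ := CuspFormClass.exists_bound (hf.powForm hN)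
  have hpos : 2 * (4 * N).totient ≠ 0 := by
    have := Nat.totient_pos.mpr (show 0 < 4 * N by positivity)
    positivity
  refine ⟨max 1 C, fun z => ?_⟩
  have h1 : ‖integrand κ f f z‖ ^ (2 * (4 * N).totient) ≤ C := by
    have h := hC z
    rw [le_div_iff₀ (Real.rpow_pos_of_pos z.im_pos _)] at h
    refine le_trans (le_of_eq ?_) h
    rw [integrand_self, Complex.norm_real, Real.norm_of_nonneg (by positivity), mul_pow, ← pow_mul,
      ← Real.rpow_natCast (z.im ^ weight κ), ← Real.rpow_mul z.im_pos.le]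
    change _ = ‖(f ^ (4 * (4 * N).totient)) z‖ * _
    rw [Pi.pow_apply, norm_pow, weight]
    congr 2
    · ring
    · push_cast
      ring
  by_contra hcon
  push Not at hcon
  have h2 := (le_max_left _ _).trans hcon.le
  exact absurd (((le_self_pow₀ h2 hpos).trans h1).trans (le_max_right 1 C)) (not_le.mpr hcon)

end

open MeasureTheory

/-! ### The action of `SL₂(ℤ)` on the hyperbolic plane -/

instance : MeasurableConstSMul SL(2, ℤ) ℍ where
  measurable_const_smul γ := measurable_const_smul (Matrix.SpecialLinearGroup.mapGL ℝ γ)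

instance : SMulInvariantMeasure SL(2, ℤ) ℍ volume where
  measure_preimage_smul γ _ hs :=
    SMulInvariantMeasure.measure_preimage_smul (Matrix.SpecialLinearGroup.mapGL ℝ γ) hs

instance : Countable SL(2, ℤ) :=
  have : Countable (Matrix (Fin 2) (Fin 2) ℤ) := inferInstanceAs (Countable (Fin 2 → Fin 2 → ℤ))
  Subtype.countable


lemma volume_fd_diff_fdo : volume (ModularGroup.fd \ ModularGroup.fdo) = 0 := by
  have hre : ∀ c : ℝ, volume {z : ℂ | z.re = c} = 0 := fun c => by
    rw [← Complex.frontier_setOfPred_re_lt]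
    exact (convex_halfSpace_re_lt c).addHaar_frontier volume
  have hsph : volume (Metric.sphere (0 : ℂ) 1) = 0 := Measure.addHaar_sphere volume 0 1
  rw [volume_eq_lintegral]
  refine setLIntegral_measure_zero _ _ (measure_mono_null (t := Metric.sphere (0 : ℂ) 1 ∪
    ({z : ℂ | z.re = 1 / 2} ∪ {z : ℂ | z.re = -(1 / 2)})) ?_ ?_)
  · rintro _ ⟨z, ⟨⟨h1, h2⟩, h3⟩, rfl⟩
    rcases h1.eq_or_lt with h1 | h1
    · left
      rw [mem_sphere_zero_iff_norm]
      rw [Complex.normSq_eq_norm_sq] at h1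
      nlinarith [norm_nonneg (z : ℂ)]
    · right
      have h4 : |z.re| = 1 / 2 := le_antisymm h2 (not_lt.mp fun h => h3 ⟨h1, h⟩)
      exact eq_or_eq_neg_of_abs_eq h4
  · exact measure_union_null hsph (measure_union_null (hre _) (hre _))

/-- The domain lies in the strip `|x| ≤ 1/2`, `y > 1/2`, where `y^(-2)` is integrable. -/
lemma volume_fd_lt_top : volume (ModularGroup.fd) < ⊤ := by
  have hsub : (UpperHalfPlane.coe '' ModularGroup.fd) ⊆
      Complex.measurableEquivRealProd ⁻¹' (Set.Icc (-(1 / 2)) (1 / 2) ×ˢ Set.Ioi (1 / 2)) := by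
    rintro _ ⟨z, hz, rfl⟩
    have h1 := ModularGroup.three_le_four_mul_im_sq_of_mem_fd hz
    have h2 := abs_le.mp hz.2
    have h3 := z.im_pos
    refine ⟨h2, ?_⟩
    change 1 / 2 < z.im
    nlinarith
  rw [volume_eq_lintegral]
  refine lt_of_le_of_lt (lintegral_mono_set hsub) ?_
  have key := Complex.volume_preserving_equiv_real_prod.setLIntegral_comp_preimage_emb
    Complex.measurableEquivRealProd.measurableEmbedding
    (fun q : ℝ × ℝ => (((1 / ‖q.2‖₊) ^ 2 : NNReal) : ENNReal))
    (Set.Icc (-(1 / 2)) (1 / 2) ×ˢ Set.Ioi (1 / 2))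
  simp only [Complex.measurableEquivRealProd_apply] at key
  have hprod := lintegral_prod_mul (μ := volume.restrict (Set.Icc (-(1 / 2) : ℝ) (1 / 2)))
    (ν := volume.restrict (Set.Ioi (1 / 2 : ℝ))) (f := fun _ => 1)
    (g := fun y : ℝ => (((1 / ‖y‖₊) ^ 2 : NNReal) : ENNReal)) aemeasurable_const (by fun_prop)
  simp only [one_mul] at hprod
  rw [key, Measure.volume_eq_prod, ← Measure.prod_restrict, hprod]
  refine ENNReal.mul_lt_top (by simp) ?_
  have hint := (integrableOn_Ioi_rpow_of_lt (a := -2) (by norm_num)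
    (show (0 : ℝ) < 1 / 2 by norm_num)).lintegral_lt_top
  refine lt_of_le_of_lt (le_of_eq (setLIntegral_congr_fun measurableSet_Ioi fun y hy => ?_)) hint
  have hy' : 0 < y := lt_trans (by norm_num) (Set.mem_Ioi.mp hy)
  change _ = ENNReal.ofReal (y ^ (-2 : ℝ))
  rw [ENNReal.ofReal, ENNReal.coe_inj]
  ext
  rw [Real.coe_toNNReal _ (by positivity), Real.rpow_neg hy'.le]
  simp

instance : (volume : Measure ℍ).IsOpenPosMeasure where
  open_pos U hU hne := by
    intro h0
    rw [volume_eq_lintegral] at h0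
    have hopen : IsOpen (UpperHalfPlane.coe '' U) := isOpenEmbedding_coe.isOpenMap U hU
    rw [setLIntegral_eq_zero_iff hopen.measurableSet (by fun_prop)] at h0
    have h1 : ∀ᵐ z : ℂ, z ∉ UpperHalfPlane.coe '' U := by
      filter_upwards [h0] with z hz hzU
      have h2 := hz hzU
      obtain ⟨w, -, rfl⟩ := hzU
      have := w.im_ne_zero
      simp at h2
      exact this h2
    have h3 : volume (UpperHalfPlane.coe '' U) = 0 := by
      rw [← compl_compl (UpperHalfPlane.coe '' U)]
      exact h1
    exact (hopen.measure_pos volume (hne.image _)).ne' h3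

/-! ### Fundamental domains -/

/-- The union of the translates of the standard fundamental domain of `SL₂(ℤ)` by `s i`. -/
def fundUnion {ι : Type*} (s : ι → SL(2, ℤ)) : Set ℍ :=
  ⋃ i, (fun z : ℍ => s i • z) '' ModularGroup.fd

lemma measurableSet_image_fd (g : SL(2, ℤ)) :
    MeasurableSet ((fun z : ℍ => g • z) '' ModularGroup.fd) :=
  (measurableEmbedding_const_smul g).measurableSet_image.mpr
    ModularGroup.isClosed_fd.measurableSet

/-- Unless `g = ±g'`, the two translates can meet only along the boundary, which is null. -/
lemma volume_image_fd_inter {g g' : SL(2, ℤ)} (h : g ≠ g') (h' : g ≠ -g') :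
    volume ((fun z : ℍ => g • z) '' ModularGroup.fd ∩ (fun z : ℍ => g' • z) '' ModularGroup.fd) =
      0 := by
  refine measure_mono_null (t := (fun z : ℍ => g • z) '' (ModularGroup.fd \ ModularGroup.fdo)) ?_ ?_
  · rintro _ ⟨⟨w, hw, rfl⟩, w', hw', hww⟩
    refine ⟨w, ⟨hw, fun hwo => ?_⟩, rfl⟩
    have h1 : (g'⁻¹ * g) • w = w' := by
      rw [mul_smul, inv_smul_eq_iff]
      exact hww.symm
    rcases ModularGroup.eq_one_or_neg_one_of_mem_fdo_mem_fd hwo (h1 ▸ hw') with h2 | h2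
    · exact h (inv_mul_eq_one.mp h2).symm
    · refine h' ?_
      rw [inv_mul_eq_iff_eq_mul] at h2
      rw [h2, mul_neg, mul_one]
  · rw [Set.image_smul, measure_smul, volume_fd_diff_fdo]

/-- Thus `Γ₀(4) = ±Γ₁(4)`, and `Γ₁(4)` selects one element from each pair `±k`. -/
lemma mem_Gamma1_four_or_neg {k : SL(2, ℤ)} (hk : k ∈ Gamma0 4) :
    k ∈ Gamma1 4 ∨ -k ∈ Gamma1 4 := by
  have h10 := Gamma0_mem.mp hk
  have h := congrArg (Int.cast : ℤ → ZMod 4) (det_eq_one k)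
  push_cast at h
  rw [h10, mul_zero, sub_zero] at h
  have key : ∀ a d : ZMod 4, a * d = 1 → (a = 1 ∧ d = 1) ∨ (-a = 1 ∧ -d = 1) := by decide
  rcases key _ _ h with ⟨h1, h2⟩ | ⟨h1, h2⟩
  · exact Or.inl ((Gamma1_mem 4 k).mpr ⟨h1, h2, h10⟩)
  · refine Or.inr ((Gamma1_mem 4 (-k)).mpr ?_)
    simp only [Matrix.SpecialLinearGroup.coe_neg, Matrix.neg_apply]
    push_cast
    exact ⟨h1, h2, by rw [h10, neg_zero]⟩

lemma neg_one_notMem_Gamma1_four : (-1 : SL(2, ℤ)) ∉ Gamma1 4 := by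
  intro h
  have h1 := ((Gamma1_mem 4 _).mp h).1
  simp at h1
  exact absurd h1 (by decide)

section

variable {ι : Type*} {K : Subgroup SL(2, ℤ)} {s : ι → SL(2, ℤ)}

lemma ne_and_ne_neg_of_existsUnique (hneg : -1 ∈ K) (hs : ∀ g, ∃! i, g * (s i)⁻¹ ∈ K) {i j : ι}
    (hij : i ≠ j) : s i ≠ s j ∧ s i ≠ -s j := by
  have hi : s i * (s i)⁻¹ ∈ K := by rw [mul_inv_cancel]; exact K.one_mem
  refine ⟨fun h => hij ((hs (s i)).unique hi ?_), fun h => hij ((hs (s i)).unique hi ?_)⟩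
  · rw [h, mul_inv_cancel]
    exact K.one_mem
  · rw [h, neg_mul, mul_inv_cancel]
    exact hneg

/-- Since `-1` acts trivially, `K` itself has two elements with the same action and its translates
cannot be almost disjoint. Intersecting with `Γ₁(4)`, which omits `-1`, leaves the orbits unchanged
and removes this duplication. -/
theorem isFundamentalDomain_fundUnion [Countable ι] (hK : K ≤ Gamma0 4) (hneg : -1 ∈ K)
    (hs : ∀ g, ∃! i, g * (s i)⁻¹ ∈ K) :
    IsFundamentalDomain (K ⊓ Gamma1 4 : Subgroup SL(2, ℤ)) (fundUnion s) volume where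
  nullMeasurableSet := (MeasurableSet.iUnion fun i => measurableSet_image_fd (s i)).nullMeasurableSet
  ae_covers := by
    refine Filter.Eventually.of_forall fun z => ?_
    obtain ⟨g, hg⟩ := ModularGroup.exists_smul_mem_fd z
    obtain ⟨i, hi, -⟩ := hs g⁻¹
    have hmem : (g⁻¹ * (s i)⁻¹)⁻¹ • z ∈ fundUnion s := by
      refine Set.mem_iUnion.mpr ⟨i, g • z, hg, ?_⟩
      rw [mul_inv_rev, inv_inv, inv_inv, mul_smul]
    have hi' := K.inv_mem hi
    rcases mem_Gamma1_four_or_neg (hK hi') with h | h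
    · exact ⟨⟨_, hi', h⟩, hmem⟩
    · refine ⟨⟨_, ?_, h⟩, ?_⟩
      · rw [← neg_one_mul]
        exact K.mul_mem hneg hi'
      · change (-(g⁻¹ * (s i)⁻¹)⁻¹) • z ∈ _
        rwa [ModularGroup.SL_neg_smul]
  aedisjoint := by
    rintro ⟨g, hg⟩ ⟨g', hg'⟩ hne
    have hne' : g ≠ g' := fun h => hne (Subtype.ext h)
    change volume ((fun z : ℍ => g • z) '' fundUnion s ∩ (fun z : ℍ => g' • z) '' fundUnion s) = 0
    rw [fundUnion, Set.image_iUnion, Set.image_iUnion, Set.iUnion_inter_iUnion]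
    refine measure_iUnion_null fun i => measure_iUnion_null fun j => ?_
    simp only [Set.image_image, ← mul_smul]
    have hdich : ∀ ε : SL(2, ℤ), ε ∈ K → g * s i = g' * (ε * s j) → i = j := by
      intro ε hε h
      have h1 : s i = g⁻¹ * g' * ε * s j := by
        rw [mul_assoc, mul_assoc, ← h, inv_mul_cancel_left]
      refine (hs (s i)).unique (by rw [mul_inv_cancel]; exact K.one_mem) ?_
      rw [h1, mul_inv_cancel_right]
      exact K.mul_mem (K.mul_mem (K.inv_mem hg.1) hg'.1) hε
    refine volume_image_fd_inter (fun h => ?_) (fun h => ?_)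
    · have hij := hdich 1 K.one_mem (by rw [one_mul]; exact h)
      subst hij
      exact hne' (mul_right_cancel h)
    · have hij := hdich (-1) hneg (by rw [neg_one_mul, mul_neg]; exact h)
      subst hij
      rw [← neg_mul] at h
      have h2 := mul_right_cancel h
      refine neg_one_notMem_Gamma1_four ?_
      have h3 : g * g'⁻¹ = -1 := by rw [h2, neg_mul, mul_inv_cancel]
      rw [← h3]
      exact (Gamma1 4).mul_mem hg.2 ((Gamma1 4).inv_mem hg'.2)

lemma integrableOn_fd {F : ℍ → ℂ} (hF : Continuous F) {C : ℝ} (hC : ∀ z, ‖F z‖ ≤ C) :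
    IntegrableOn F ModularGroup.fd volume :=
  Measure.integrableOn_of_bounded volume_fd_lt_top.ne hF.aestronglyMeasurable
    (Filter.Eventually.of_forall hC)

lemma setIntegral_image_fd (g : SL(2, ℤ)) (F : ℍ → ℂ) :
    ∫ z in (fun z : ℍ => g • z) '' ModularGroup.fd, F z = ∫ z in ModularGroup.fd, F (g • z) :=
  (measurePreserving_smul g volume).setIntegral_image_emb (measurableEmbedding_const_smul g) F _

lemma volume_image_fd_lt_top (g : SL(2, ℤ)) :
    volume ((fun z : ℍ => g • z) '' ModularGroup.fd) < ⊤ := by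
  rw [Set.image_smul, measure_smul]
  exact volume_fd_lt_top

lemma integrableOn_fundUnion [Finite ι] {F : ℍ → ℂ} (hF : Continuous F)
    {C : ℝ} (hC : ∀ z, ‖F z‖ ≤ C) : IntegrableOn F (fundUnion s) volume :=
  integrableOn_finite_iUnion.mpr fun i => Measure.integrableOn_of_bounded
    (volume_image_fd_lt_top (s i)).ne hF.aestronglyMeasurable (Filter.Eventually.of_forall hC)

lemma setIntegral_fundUnion [Fintype ι] (hneg : -1 ∈ K) (hs : ∀ g, ∃! i, g * (s i)⁻¹ ∈ K)
    {F : ℍ → ℂ} (hF : Continuous F) {C : ℝ} (hC : ∀ z, ‖F z‖ ≤ C) :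
    ∫ z in fundUnion s, F z = ∑ i, ∫ z in ModularGroup.fd, F (s i • z) := by
  rw [fundUnion, integral_iUnion_ae (fun i => (measurableSet_image_fd (s i)).nullMeasurableSet) _
    (integrableOn_fundUnion hF hC), tsum_fintype]
  · exact Finset.sum_congr rfl fun i _ => setIntegral_image_fd (s i) F
  · intro i j hij
    obtain ⟨h, h'⟩ := ne_and_ne_neg_of_existsUnique hneg hs hij
    exact volume_image_fd_inter h h'

end

/-! ### Unfolding an integral to level `4N` -/

lemma neg_one_mem_Gamma0 (M : ℕ) : (-1 : SL(2, ℤ)) ∈ Gamma0 M := by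
  rw [mem_Gamma0_iff_dvd]
  simp

lemma fundDomain_eq_fundUnion (N : ℕ) : fundDomain N =
    fundUnion (fun q : Quotient (QuotientGroup.rightRel (Gamma0 (4 * N))) => Quotient.out q) := rfl

lemma finite_quotient_rightRel {G : Type*} [Group G] {K : Subgroup G} (h : K.index ≠ 0) :
    Finite (Quotient (QuotientGroup.rightRel K)) :=
  have : K.FiniteIndex := ⟨h⟩
  have : Finite (G ⧸ K) := inferInstance
  Finite.of_equiv _ (QuotientGroup.quotientRightRelEquivQuotientLeftRel K).symm

lemma existsUnique_mul_inv_prod_mem {G : Type*} [Group G] {H K : Subgroup G} (hKH : K ≤ H) (g : G) :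
    ∃! q : Quotient (QuotientGroup.rightRel (K.subgroupOf H)) ×
      Quotient (QuotientGroup.rightRel H), g * (((Quotient.out q.1 : H) : G) * Quotient.out q.2)⁻¹ ∈ K := by
  obtain ⟨i, hi, hi'⟩ := existsUnique_mul_inv_out_mem (K := H) g
  obtain ⟨ν, hν, hν'⟩ := existsUnique_mul_inv_out_mem (K := K.subgroupOf H) ⟨_, hi⟩
  have hrw : ∀ (a : H) (b : G), g * ((a : G) * b)⁻¹ = g * b⁻¹ * (a : G)⁻¹ := fun a b => by
    rw [mul_inv_rev, mul_assoc]
  refine ⟨(ν, i), by simp only [hrw]; exact hν, ?_⟩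
  rintro ⟨ν₂, i₂⟩ h
  simp only [hrw] at h
  have h1 : i₂ = i := hi' i₂ (by
    have := H.mul_mem (hKH h) (Quotient.out ν₂).2
    rwa [inv_mul_cancel_right] at this)
  subst h1
  rw [hν' ν₂ (Subgroup.mem_subgroupOf.mpr h)]

/-- Unfolding from a subgroup `K` of finite index in `Γ₀(4N)`. -/
theorem setIntegral_eq_setIntegral_fundDomain {N : ℕ} (hN : 0 < N) {K : Subgroup SL(2, ℤ)}
    (hK : K ≤ Gamma0 (4 * N)) (hneg : -1 ∈ K) {L : Subgroup (Gamma0 (4 * N))}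
    (hL : K.subgroupOf (Gamma0 (4 * N)) = L) (hind : L.index ≠ 0)
    {D : Set ℍ} (hD : IsFundamentalDomain (K ⊓ Gamma1 4 : Subgroup SL(2, ℤ)) D volume)
    {F : ℍ → ℂ} (hF : Continuous F) {C : ℝ} (hC : ∀ z, ‖F z‖ ≤ C)
    (hinv : ∀ g ∈ K, ∀ z : ℍ, F (g • z) = F z) :
    ∫ z in D, F z = ∫ z in fundDomain N,
      ∑ᶠ q : Quotient (QuotientGroup.rightRel L),
        F (((Quotient.out q : Gamma0 (4 * N)) : SL(2, ℤ)) • z) := by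
  subst hL
  have hN0 : NeZero (4 * N) := ⟨by positivity⟩
  have hfin := finite_quotient_rightRel hind
  have hfin' := finite_quotient_rightRel (K := Gamma0 (4 * N)) Subgroup.FiniteIndex.index_ne_zero
  have := Fintype.ofFinite (Quotient (QuotientGroup.rightRel (K.subgroupOf (Gamma0 (4 * N)))))
  have := Fintype.ofFinite (Quotient (QuotientGroup.rightRel (Gamma0 (4 * N))))
  have hs := existsUnique_mul_inv_prod_mem hK
  have hcont : ∀ g : SL(2, ℤ), Continuous fun z : ℍ => F (g • z) := fun g =>
    hF.comp (continuous_const_smul (Matrix.SpecialLinearGroup.mapGL ℝ g))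
  simp only [finsum_eq_sum_of_fintype]
  -- Invariance of `F` allows `D` to be replaced by the translates of the standard domain under
  -- products of representatives for `K \ Γ₀(4N)` and `Γ₀(4N) \ SL₂(ℤ)`.
  rw [hD.setIntegral_eq (isFundamentalDomain_fundUnion (hK.trans (Gamma0_le_four N)) hneg hs)
    (fun g z => hinv g g.2.1 z), setIntegral_fundUnion hneg hs hF hC, fundDomain_eq_fundUnion,
    setIntegral_fundUnion (neg_one_mem_Gamma0 _) existsUnique_mul_inv_out_mem
      (continuous_finsetSum _ fun q _ => hcont _)
      (fun z => (norm_sum_le _ _).trans (Finset.sum_le_sum fun q _ => hC _)),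
    Fintype.sum_prod_type_right]
  refine Finset.sum_congr rfl fun i _ => ?_
  rw [integral_finsetSum]
  · refine Finset.sum_congr rfl fun ν _ => ?_
    simp only [mul_smul]
  · intro ν _
    simp only [← mul_smul]
    exact integrableOn_fd (hcont _) fun z => hC _

/-! ### Transport of fundamental domains by a dilation -/

lemma IsDilate.left_unique {m : ℕ} (hm : 0 < m) {γ γ₂ γ' : SL(2, ℤ)} (h : IsDilate m γ γ')
    (h₂ : IsDilate m γ₂ γ') : γ = γ₂ := by
  have h0 : (m : ℤ) ^ 2 ≠ 0 := by positivity
  ext i j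
  fin_cases i <;> fin_cases j
  · exact h.h00.symm.trans h₂.h00
  · exact mul_left_cancel₀ h0 (h.h01.symm.trans h₂.h01)
  · exact h.h10.trans h₂.h10.symm
  · exact h.h11.symm.trans h₂.h11

lemma IsDilate.right_unique {m : ℕ} (hm : 0 < m) {γ γ' γ₂ : SL(2, ℤ)} (h : IsDilate m γ γ')
    (h₂ : IsDilate m γ γ₂) : γ' = γ₂ := by
  have h0 : (m : ℤ) ^ 2 ≠ 0 := by positivity
  ext i j
  fin_cases i <;> fin_cases j
  · exact h.h00.trans h₂.h00.symm
  · exact h.h01.trans h₂.h01.symm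
  · exact mul_left_cancel₀ h0 (h.h10.symm.trans h₂.h10)
  · exact h.h11.trans h₂.h11.symm

lemma IsDilate.mem_Gamma1_four_iff {m : ℕ} {γ γ' : SL(2, ℤ)} (h : IsDilate m γ γ')
    (hγ : γ ∈ Gamma0 4) (hγ' : γ' ∈ Gamma0 4) : γ' ∈ Gamma1 4 ↔ γ ∈ Gamma1 4 := by
  rw [Gamma1_mem, Gamma1_mem, h.h00, h.h11, Gamma0_mem.mp hγ, Gamma0_mem.mp hγ']

/-- Conjugation by `ξ*` carries `Γ₀(4Nm²)` onto `Γ₀(4N) ∩ Γ⁰(m²)`. It fixes the diagonal entries, so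
it respects the condition defining `Γ₁(4)`. -/
lemma isFundamentalDomain_image_xiStar {N m : ℕ} (hm : 0 < m) {D : Set ℍ}
    (hD : IsFundamentalDomain
      (Gamma0 (4 * (N * m ^ 2)) ⊓ Gamma1 4 : Subgroup SL(2, ℤ)) D volume) :
    IsFundamentalDomain ((Gamma0 (4 * N) ⊓ GammaUpper (m ^ 2)) ⊓ Gamma1 4 : Subgroup SL(2, ℤ))
      ((fun z : ℍ => (xiStar m hm).mat • z) '' D) volume := by
  have hex : ∀ γ' : ((Gamma0 (4 * N) ⊓ GammaUpper (m ^ 2)) ⊓ Gamma1 4 : Subgroup SL(2, ℤ)),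
      ∃ γ : (Gamma0 (4 * (N * m ^ 2)) ⊓ Gamma1 4 : Subgroup SL(2, ℤ)), IsDilate m γ γ' := by
    rintro ⟨γ', ⟨h1, h2⟩, h3⟩
    obtain ⟨γ, h⟩ := exists_isDilate_left m γ' (by
      have := mem_GammaUpper.mp h2
      exact_mod_cast this)
    have h4 := h.mem_Gamma0 h1
    exact ⟨⟨γ, h4, (h.mem_Gamma1_four_iff (Gamma0_le_four _ h4) (Gamma0_le_four _ h1)).mp h3⟩, h⟩
  choose φ hφ using hex
  have hbij : Function.Bijective φ := by
    constructor
    · intro γ₁ γ₂ h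
      have h1 := hφ γ₁
      rw [h] at h1
      exact Subtype.ext (h1.right_unique hm (hφ γ₂))
    · rintro ⟨γ, h1, h3⟩
      obtain ⟨γ', h', h⟩ := exists_isDilate_of_mem_Gamma0 h1
      refine ⟨⟨γ', ⟨h', h.mem_GammaUpper⟩,
        (h.mem_Gamma1_four_iff (Gamma0_le_four _ h1) (Gamma0_le_four _ h')).mpr h3⟩, ?_⟩
      exact Subtype.ext ((hφ _).left_unique hm h)
  refine hD.image_of_equiv (MulAction.toPerm (xiStar m hm).mat)
    (measurePreserving_smul (xiStar m hm).mat⁻¹ volume).quasiMeasurePreserving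
    (Equiv.ofBijective φ hbij) fun γ' z => ?_
  change (xiStar m hm).mat • Matrix.SpecialLinearGroup.mapGL ℝ (φ γ' : SL(2, ℤ)) • z =
    Matrix.SpecialLinearGroup.mapGL ℝ (γ' : SL(2, ℤ)) • (xiStar m hm).mat • z
  rw [← mul_smul, ← mul_smul, (isDilate_iff_xiStar hm).mp (hφ γ')]

/-- The product `ξ ξ*` lies over the scalar matrix `m²` with factor 1, so it acts trivially. -/
lemma slash_xi_xiStar (κ : ℕ) {m : ℕ} (hm : 0 < m) (f : ℍ → ℂ) :
    slash κ (slash κ f (xi m hm)) (xiStar m hm) = f := by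
  funext z
  have h1 : (xi m hm).mat • (xiStar m hm).mat • z = z := by
    ext1
    have h := coe_xi_smul hm ((xiStar m hm).mat • z)
    rw [coe_xiStar_smul] at h
    have h0 : (m : ℂ) ^ 2 ≠ 0 := pow_ne_zero 2 (by exact_mod_cast hm.ne')
    exact mul_left_cancel₀ h0 h
  have h2 : ((Real.sqrt m : ℝ) : ℂ) ≠ 0 :=
    Complex.ofReal_ne_zero.mpr (Real.sqrt_pos.mpr (Nat.cast_pos.mpr hm)).ne'
  rw [slash, slash, h1]
  change f z * (((Real.sqrt m : ℝ) : ℂ) ^ (2 * κ + 1))⁻¹ *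
    ((((Real.sqrt m : ℝ) : ℂ)⁻¹) ^ (2 * κ + 1))⁻¹ = f z
  rw [inv_pow, inv_inv, mul_assoc, inv_mul_cancel₀ (pow_ne_zero _ h2), mul_one]

/-! ### Unfolding and positivity of the Petersson integral -/

section

variable {κ N : ℕ} {χ : DirichletCharacter ℂ (4 * N)} {f : ℍ → ℂ}

lemma IsCuspForm.continuous (hf : IsCuspForm κ χ f) : Continuous f := hf.holo.continuous

lemma integrand_smul_of_slash_eq {g₁ g₂ : ℍ → ℂ} {γ : Gamma0 (4 * N)}
    (h₁ : slash κ g₁ (toDelta γ) = charGamma χ γ • g₁)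
    (h₂ : slash κ g₂ (toDelta γ) = charGamma χ γ • g₂) (z : ℍ) :
    integrand κ g₁ g₂ ((γ : SL(2, ℤ)) • z) = integrand κ g₁ g₂ z := by
  have h := integrand_slash κ g₁ g₂ (toDelta γ) z
  rw [h₁, h₂, integrand_smul_left, integrand_smul_right, ← mul_assoc, mul_comm (charGamma χ γ),
    conj_mul_charGamma, one_mul] at h
  exact h.symm

lemma norm_integrand_le {g₁ g₂ : ℍ → ℂ} {C : ℝ} (h₁ : ∀ z, ‖integrand κ g₁ g₁ z‖ ≤ C)
    (h₂ : ∀ z, ‖integrand κ g₂ g₂ z‖ ≤ C) (z : ℍ) : ‖integrand κ g₁ g₂ z‖ ≤ C := by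
  have hC : 0 ≤ C := (norm_nonneg _).trans (h₁ z)
  refine le_of_sq_le_sq ?_ hC
  rw [norm_integrand_sq, pow_two]
  exact mul_le_mul (h₁ z) (h₂ z) (norm_nonneg _) hC

/-- Moving the argument by `γ` slashes both functions by `γ*`. The resulting `χ(γ)` from `f` becomes
the coefficient `conj(χ(γ))` inside the conjugated slot. -/
lemma finsum_integrand_right (hf : IsCuspForm κ χ f) {K : Subgroup (Gamma0 (4 * N))}
    (hK : K.index ≠ 0) (g : ℍ → ℂ) (z : ℍ) :
    ∑ᶠ q : Quotient (QuotientGroup.rightRel K),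
      integrand κ f g (((Quotient.out q : Gamma0 (4 * N)) : SL(2, ℤ)) • z) =
        integrand κ f (cosetSum κ χ K g) z := by
  have hfin := finite_quotient_rightRel hK
  have := Fintype.ofFinite (Quotient (QuotientGroup.rightRel K))
  rw [cosetSum, finsum_eq_sum_of_fintype, finsum_eq_sum_of_fintype]
  have hterm : ∀ γ : Gamma0 (4 * N), integrand κ f g ((γ : SL(2, ℤ)) • z) =
      f z * conj ((conj (charGamma χ γ) • slash κ g (toDelta γ)) z) *
        ((z.im ^ weight κ : ℝ) : ℂ) := by
    intro γ
    have h := integrand_slash κ f g (toDelta γ) z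
    rw [hf.slash_eq, integrand_smul_left] at h
    refine h.symm.trans ?_
    rw [integrand, Pi.smul_apply, smul_eq_mul, map_mul, Complex.conj_conj]
    ring
  simp only [hterm]
  rw [integrand, Finset.sum_apply, map_sum, Finset.mul_sum, Finset.sum_mul]

lemma finsum_integrand_left (hf : IsCuspForm κ χ f) {K : Subgroup (Gamma0 (4 * N))}
    (hK : K.index ≠ 0) (g : ℍ → ℂ) (z : ℍ) :
    ∑ᶠ q : Quotient (QuotientGroup.rightRel K),
      integrand κ g f (((Quotient.out q : Gamma0 (4 * N)) : SL(2, ℤ)) • z) =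
        integrand κ (cosetSum κ χ K g) f z := by
  have hfin := finite_quotient_rightRel hK
  have := Fintype.ofFinite (Quotient (QuotientGroup.rightRel K))
  rw [cosetSum, finsum_eq_sum_of_fintype, finsum_eq_sum_of_fintype]
  have hterm : ∀ γ : Gamma0 (4 * N), integrand κ g f ((γ : SL(2, ℤ)) • z) =
      (conj (charGamma χ γ) • slash κ g (toDelta γ)) z * conj (f z) *
        ((z.im ^ weight κ : ℝ) : ℂ) := by
    intro γ
    have h := integrand_slash κ g f (toDelta γ) z
    rw [hf.slash_eq, integrand_smul_right] at h
    refine h.symm.trans ?_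
    rw [integrand, Pi.smul_apply, smul_eq_mul]
    ring
  simp only [hterm]
  rw [integrand, Finset.sum_apply, Finset.sum_mul, Finset.sum_mul]

lemma isFundamentalDomain_fundDomain {M : ℕ} (hM : 0 < M) :
    IsFundamentalDomain (Gamma0 (4 * M) ⊓ Gamma1 4 : Subgroup SL(2, ℤ)) (fundDomain M) volume := by
  have : NeZero (4 * M) := ⟨by positivity⟩
  have := finite_quotient_rightRel (K := Gamma0 (4 * M)) Subgroup.FiniteIndex.index_ne_zero
  exact isFundamentalDomain_fundUnion (Gamma0_le_four M) (neg_one_mem_Gamma0 _)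
    existsUnique_mul_inv_out_mem

lemma upperSubgroup_index_ne_zero {m : ℕ} (hm : 0 < m) : (upperSubgroup N m).index ≠ 0 := by
  have : NeZero (m ^ 2) := ⟨by positivity⟩
  have hle : Gamma (m ^ 2) ≤ GammaUpper (m ^ 2) := fun γ hγ =>
    mem_GammaUpper.mpr ((ZMod.intCast_zmod_eq_zero_iff_dvd _ _).mp (Gamma_mem.mp hγ).2.1)
  have := Subgroup.finiteIndex_of_le hle
  exact Subgroup.FiniteIndex.index_ne_zero

lemma neg_one_mem_GammaUpper (M : ℕ) : (-1 : SL(2, ℤ)) ∈ GammaUpper M := by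
  rw [mem_GammaUpper]
  simp

lemma IsCuspForm.apply_smul_ne_zero_iff (hf : IsCuspForm κ χ f) (γ : Gamma0 (4 * N)) (z : ℍ) :
    f ((γ : SL(2, ℤ)) • z) ≠ 0 ↔ f z ≠ 0 := by
  have h := congrFun (hf.slash_eq γ) z
  have h1 := inv_ne_zero (pow_ne_zero (2 * κ + 1) ((toDelta γ).fac_ne_zero z))
  have h2 : f ((γ : SL(2, ℤ)) • z) * _ = charGamma χ γ * f z := h
  rw [← mul_ne_zero_iff_right h1, h2, mul_ne_zero_iff_left (charGamma_ne_zero χ γ)]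

/-- A vanishing integral of `|f|² y^k` makes the open invariant set `f ≠ 0` null on a fundamental
domain, hence null, hence empty. -/
theorem setIntegral_integrand_self_ne_zero (hf : IsCuspForm κ χ f) (h0 : f ≠ 0) (hN : 0 < N) :
    ∫ z in fundDomain N, integrand κ f f z ≠ 0 := by
  have hN0 : NeZero (4 * N) := ⟨by positivity⟩
  have hfin := finite_quotient_rightRel (K := Gamma0 (4 * N)) Subgroup.FiniteIndex.index_ne_zero
  obtain ⟨C, hC⟩ := hf.exists_norm_integrand_le hN
  have hint : IntegrableOn (integrand κ f f) (fundDomain N) volume :=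
    integrableOn_fundUnion (continuous_integrand hf.continuous hf.continuous) hC
  intro h
  have hre : ∀ z, integrand κ f f z = ((‖f z‖ ^ 2 * z.im ^ weight κ : ℝ) : ℂ) :=
    integrand_self κ f
  have hint' : IntegrableOn (fun z : ℍ => ‖f z‖ ^ 2 * z.im ^ weight κ) (fundDomain N) volume := by
    have := hint.re
    refine this.congr (Filter.Eventually.of_forall fun z => ?_)
    simp only [hre]
    exact RCLike.ofReal_re _
  simp only [hre] at h
  rw [integral_complex_ofReal, Complex.ofReal_eq_zero,
    integral_eq_zero_iff_of_nonneg (fun z => by positivity) hint'] at h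
  have hopen : IsOpen {z | f z ≠ 0} := isOpen_ne_fun hf.continuous continuous_const
  have hzero : volume ({z | f z ≠ 0} ∩ fundDomain N) = 0 := by
    rw [← Measure.restrict_apply hopen.measurableSet]
    refine measure_mono_null (fun z hz => ?_) (ae_iff.mp h)
    have hz' : 0 < ‖f z‖ := norm_pos_iff.mpr hz
    exact (mul_pos (pow_pos hz' 2) (Real.rpow_pos_of_pos z.im_pos _)).ne'
  have hvol : volume {z | f z ≠ 0} = 0 := by
    refine (isFundamentalDomain_fundDomain hN).measure_zero_of_invariant _ (fun g => ?_) hzero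
    ext z
    rw [Set.mem_smul_set_iff_inv_smul_mem]
    exact hf.apply_smul_ne_zero_iff ⟨_, (g⁻¹).2.1⟩ z
  have hempty := (hopen.measure_eq_zero_iff volume).mp hvol
  refine h0 (funext fun z => ?_)
  by_contra hz
  have : z ∈ {z | f z ≠ 0} := hz
  rw [hempty] at this
  exact this

variable {m : ℕ} (hm : 0 < m)

/-- The `T*` side of adjointness: the integrand is invariant under `Γ₀(4Nm²)`, so it unfolds
directly. -/
theorem setIntegral_integrand_eq_lower (hf : IsCuspForm κ χ f) (hN : 0 < N) :
    ∫ z in fundDomain (N * m ^ 2), integrand κ f (slash κ f (xiStar m hm)) z =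
      ∫ z in fundDomain N,
        integrand κ f (cosetSum κ χ (lowerSubgroup N m) (slash κ f (xiStar m hm))) z := by
  obtain ⟨C, hC⟩ := hf.exists_norm_integrand_le hN
  rw [setIntegral_eq_setIntegral_fundDomain hN (K := Gamma0 (4 * (N * m ^ 2))) (Gamma0_mul_le N _)
    (neg_one_mem_Gamma0 _) rfl (levelIndex_ne_zero hN hm)
    (isFundamentalDomain_fundDomain (by positivity))
    (continuous_integrand hf.continuous (continuous_slash hf.continuous _))
    (norm_integrand_le hC fun z => by rw [integrand_slash]; exact hC _)]
  · simp only [finsum_integrand_right hf (levelIndex_ne_zero hN hm)]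
  · intro γ hγ z
    obtain ⟨γ', h, h'⟩ := exists_xiStar_mul_toDelta hm χ ⟨γ, Gamma0_mul_le N _ hγ⟩ hγ
    exact integrand_smul_of_slash_eq (hf.slash_eq ⟨γ, Gamma0_mul_le N _ hγ⟩)
      (by rw [slash_slash_of_commute hf h, h']) z

/-- The `T` side: the substitution `z ↦ m² z` turns `f, f|ξ*` into `f|ξ, f` and the group into
`Γ₀(4N) ∩ Γ⁰(m²)`. -/
theorem setIntegral_integrand_eq_upper (hf : IsCuspForm κ χ f) (hN : 0 < N) :
    ∫ z in fundDomain (N * m ^ 2), integrand κ f (slash κ f (xiStar m hm)) z =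
      ∫ z in fundDomain N,
        integrand κ (cosetSum κ χ (upperSubgroup N m) (slash κ f (xi m hm))) f z := by
  obtain ⟨C, hC⟩ := hf.exists_norm_integrand_le hN
  have hpoint : ∀ z, integrand κ f (slash κ f (xiStar m hm)) z =
      integrand κ (slash κ f (xi m hm)) f ((xiStar m hm).mat • z) := fun z => by
    rw [← integrand_slash, slash_xi_xiStar]
  simp only [hpoint]
  rw [← (measurePreserving_smul (xiStar m hm).mat volume).setIntegral_image_emb
      (measurableEmbedding_const_smul _) (integrand κ (slash κ f (xi m hm)) f),
    setIntegral_eq_setIntegral_fundDomain hN (K := Gamma0 (4 * N) ⊓ GammaUpper (m ^ 2))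
    (L := upperSubgroup N m) inf_le_left
    ⟨neg_one_mem_Gamma0 _, neg_one_mem_GammaUpper _⟩ (Subgroup.inf_subgroupOf_left _ _)
    (upperSubgroup_index_ne_zero hm)
    (isFundamentalDomain_image_xiStar hm (isFundamentalDomain_fundDomain (by positivity)))
    (continuous_integrand (continuous_slash hf.continuous _) hf.continuous)
    (norm_integrand_le (fun z => by rw [integrand_slash]; exact hC _) hC)]
  · simp only [finsum_integrand_left hf (upperSubgroup_index_ne_zero hm)]
  · rintro γ ⟨hγ, hγ'⟩ z
    obtain ⟨γ', h, h'⟩ := exists_xi_mul_toDelta hm χ ⟨γ, hγ⟩ hγ'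
    exact integrand_smul_of_slash_eq (γ := ⟨γ, hγ⟩) (by rw [slash_slash_of_commute hf h, h'])
      (hf.slash_eq ⟨γ, hγ⟩) z

end

/-! ### Hecke eigenforms -/

section

variable {κ N : ℕ} {χ : DirichletCharacter ℂ (4 * N)} {f : ℍ → ℂ}

lemma petersson_eq (κ N : ℕ) (g₁ g₂ : ℍ → ℂ) : petersson κ N g₁ g₂ =
    ((Gamma0 (4 * N)).index : ℂ)⁻¹ * ∫ z in fundDomain N, integrand κ g₁ g₂ z := rfl

lemma petersson_smul_right (c : ℂ) (g₁ g₂ : ℍ → ℂ) :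
    petersson κ N g₁ (c • g₂) = conj c * petersson κ N g₁ g₂ := by
  simp only [petersson_eq, integrand_smul_right]
  rw [integral_const_mul]
  ring

lemma index_Gamma0_mul (N n : ℕ) : (Gamma0 (4 * (N * n))).index =
    levelIndex N (N * n) * (Gamma0 (4 * N)).index :=
  (Subgroup.relIndex_mul_index (Gamma0_mul_le N n)).symm

/-- The Petersson product of an eigenform of `T(p²)` with its image under the dilation
`z ↦ p² z`, and the eigenvalue of the adjoint operator. -/
theorem eigenform_cosetSum (hf : IsCuspForm κ χ f) (h0 : f ≠ 0) (hN : 0 < N) {p : ℕ}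
    (hp : p.Prime) (hpN : ¬ p ∣ 4 * N) {L : ℂ}
    (hL : cosetSum κ χ (upperSubgroup N p) (slash κ f (xi p hp.pos)) = L • f) :
    cosetSum κ χ (lowerSubgroup N p) (slash κ f (xiStar p hp.pos)) = conj L • f ∧
      (χ (p : ZMod (4 * N)) ^ 2 = 1 → conj L = L) ∧
      petersson κ (N * p ^ 2) f (slash κ f (xiStar p hp.pos)) =
        L / ((p : ℂ) ^ 2 + p) * petersson κ N f f := by
  obtain ⟨c, hc, hχ⟩ := exists_cosetSum_lower_eq_upper hf h0 hN hp hpN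
  rw [hL, smul_smul] at hc
  have hE := setIntegral_integrand_self_ne_zero hf h0 hN
  have h1 := setIntegral_integrand_eq_lower hp.pos hf hN
  have h2 := setIntegral_integrand_eq_upper hp.pos hf hN
  rw [hc] at h1
  rw [hL] at h2
  simp only [integrand_smul_right, integrand_smul_left] at h1 h2
  rw [integral_const_mul] at h1 h2
  -- The two evaluations of the integral give `conj(c L) = L` after cancelling the nonzero integral
  -- of `|f|² y^k`.
  have hLc : c * L = conj L := by
    have h3 := mul_right_cancel₀ hE (h1.symm.trans h2)
    have h4 := congrArg conj h3
    rwa [Complex.conj_conj] at h4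
  rw [hLc] at hc
  refine ⟨hc, fun h => ?_, ?_⟩
  · rw [h, one_mul] at hχ
    rw [← hLc, hχ, one_mul]
  · rw [petersson_eq, petersson_eq, h2, index_Gamma0_mul, levelIndex_prime_sq hN hp hpN]
    push_cast
    rw [mul_inv, div_eq_mul_inv]
    ring

lemma V_eq_smul_slash {m : ℕ} (hm : 0 < m) (f : ℍ → ℂ) : V (m ^ 2) (pow_pos hm 2) f =
    (((m : ℝ) ^ (-weight κ) : ℝ) : ℂ) • slash κ f (xiStar m hm) := by
  have hm' : (0 : ℝ) < m := Nat.cast_pos.mpr hm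
  rw [slash_xiStar, smul_smul, ← Complex.ofReal_mul, ← Real.rpow_add hm', neg_add_cancel,
    Real.rpow_zero, Complex.ofReal_one, one_smul]

theorem eigenform_trace_V (hf : IsCuspForm κ χ f) (hN : 0 < N) {p : ℕ} (hp : p.Prime)
    (hpN : ¬ p ∣ 4 * N) {lam : ℂ} (hlam : heckeT κ χ p hp.pos f = lam • f) :
    (((p : ℂ) ^ 2 + (p : ℂ)) • trace κ N (N * p ^ 2) χ (V (p ^ 2) (pow_pos hp.pos 2) f) =
      (conj lam / (((p : ℝ) ^ (2 * (weight κ - 1)) : ℝ) : ℂ)) • f) ∧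
    (χ (p : ZMod (4 * N)) ^ 2 = 1 →
      ((p : ℂ) ^ 2 + (p : ℂ)) • trace κ N (N * p ^ 2) χ (V (p ^ 2) (pow_pos hp.pos 2) f) =
        (lam / (((p : ℝ) ^ (2 * (weight κ - 1)) : ℝ) : ℂ)) • f) ∧
    petersson κ (N * p ^ 2) f (V (p ^ 2) (pow_pos hp.pos 2) f) =
      (lam / (((p : ℂ) ^ 2 + (p : ℂ)) * (((p : ℝ) ^ (2 * (weight κ - 1)) : ℝ) : ℂ))) *
        petersson κ N f f := by
  have hindex : ((p : ℂ) ^ 2 + (p : ℂ)) = (levelIndex N (N * p ^ 2) : ℂ) := by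
    rw [levelIndex_prime_sq hN hp hpN]
    push_cast
    rfl
  rcases eq_or_ne f 0 with rfl | h0
  · rw [V_zero, trace_eq_cosetSum, cosetSum_zero]
    simp [petersson]
  have hp' : (0 : ℝ) < p := Nat.cast_pos.mpr hp.pos
  set a : ℂ := (((p : ℝ) ^ (weight κ - 2) : ℝ) : ℂ) with ha
  set b : ℂ := (((p : ℝ) ^ (-weight κ) : ℝ) : ℂ) with hb
  have ha0 : a ≠ 0 := Complex.ofReal_ne_zero.mpr (Real.rpow_pos_of_pos hp' _).ne'
  -- Here `a = p^(k-2)` is the normalization of `T(p²)` and `b = p^(-k)` converts `f|ξ*` to `f|V`;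
  -- together they give the constant `p^(-2(k-1))`.
  have hab : b * a⁻¹ = ((((p : ℝ) ^ (2 * (weight κ - 1)) : ℝ) : ℂ))⁻¹ := by
    rw [ha, hb, ← Complex.ofReal_inv, ← Complex.ofReal_inv, ← Complex.ofReal_mul,
      ← Real.rpow_neg hp'.le, ← Real.rpow_neg hp'.le, ← Real.rpow_add hp']
    congr 2
    ring
  have hL : cosetSum κ χ (upperSubgroup N p) (slash κ f (xi p hp.pos)) = (a⁻¹ * lam) • f := by
    rw [heckeT, heckeOp_eq_cosetSum hf (hf.toDelta_mul h0) _ (upperSubgroup N p)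
      (exists_xi_mul_toDelta hp.pos χ) (mem_upperSubgroup_of_xi_mul hp.pos), det_xi_rpow] at hlam
    rw [mul_smul, ← hlam, inv_smul_smul₀ ha0]
  obtain ⟨h1, h2, h3⟩ := eigenform_cosetSum hf h0 hN hp hpN hL
  have hconj : conj (a⁻¹ * lam) = a⁻¹ * conj lam := by
    rw [map_mul, map_inv₀, ha, Complex.conj_ofReal]
  have htrace : ((p : ℂ) ^ 2 + (p : ℂ)) •
      trace κ N (N * p ^ 2) χ (V (p ^ 2) (pow_pos hp.pos 2) f) =
      (conj lam / (((p : ℝ) ^ (2 * (weight κ - 1)) : ℝ) : ℂ)) • f := by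
    rw [hindex, levelIndex_smul_trace hN hp.pos, V_eq_smul_slash (κ := κ) hp.pos, cosetSum_smul, h1,
      hconj, smul_smul, ← hb, ← mul_assoc, hab, mul_comm, div_eq_mul_inv]
  refine ⟨htrace, fun h => ?_, ?_⟩
  · rw [htrace, mul_left_cancel₀ (inv_ne_zero ha0) (hconj.symm.trans (h2 h))]
  · rw [V_eq_smul_slash (κ := κ) hp.pos, petersson_smul_right, h3, Complex.conj_ofReal, ← hb, mul_comm _
      (((p : ℝ) ^ (2 * (weight κ - 1)) : ℝ) : ℂ), div_eq_mul_inv lam, mul_inv, ← hab,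
      div_eq_mul_inv]
    ring

end

end HalfIntegral

end

theorem mainTheorem5 (κ N : ℕ) (hκ : 0 < κ) (hN : 0 < N)
    (χ : DirichletCharacter ℂ (4 * N)) (f : ℍ → ℂ) (hf : HalfIntegral.IsCuspForm κ χ f) :
    (∀ (d : ℕ) (hd : 0 < d),
      (HalfIntegral.levelIndex N (N * d ^ 2) : ℂ) •
          HalfIntegral.trace κ N (N * d ^ 2) χ (HalfIntegral.V (d ^ 2) (pow_pos hd 2) f) =
        ((((d : ℝ) ^ (2 * (HalfIntegral.weight κ - 1)))⁻¹ : ℝ) : ℂ) •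
          HalfIntegral.heckeTStar κ χ d hd f) ∧
    (∀ (p : ℕ) (hp : p.Prime), ¬ p ∣ 4 * N →
      ∀ lam : ℂ, HalfIntegral.heckeT κ χ p hp.pos f = lam • f →
        (((p : ℂ) ^ 2 + (p : ℂ)) •
            HalfIntegral.trace κ N (N * p ^ 2) χ (HalfIntegral.V (p ^ 2) (pow_pos hp.pos 2) f) =
          (conj lam / (((p : ℝ) ^ (2 * (HalfIntegral.weight κ - 1)) : ℝ) : ℂ)) • f) ∧
        (χ (p : ZMod (4 * N)) ^ 2 = 1 →
          ((p : ℂ) ^ 2 + (p : ℂ)) •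
            HalfIntegral.trace κ N (N * p ^ 2) χ (HalfIntegral.V (p ^ 2) (pow_pos hp.pos 2) f) =
          (lam / (((p : ℝ) ^ (2 * (HalfIntegral.weight κ - 1)) : ℝ) : ℂ)) • f) ∧
        HalfIntegral.petersson κ (N * p ^ 2) f
            (HalfIntegral.V (p ^ 2) (pow_pos hp.pos 2) f) =
          (lam / (((p : ℂ) ^ 2 + (p : ℂ)) *
            (((p : ℝ) ^ (2 * (HalfIntegral.weight κ - 1)) : ℝ) : ℂ))) *
            HalfIntegral.petersson κ N f f) := by
  exact ⟨fun d hd => HalfIntegral.levelIndex_smul_trace_V hf hN hd,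
    fun p hp hpN lam hlam => HalfIntegral.eigenform_trace_V hf hN hp hpN hlam⟩
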